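/- **Setting.** Fix an alphabet of function symbols and predicate symbols (each with an arity) and an infinite set of variables. A query is a finite sequence of atoms; a program is a set of clauses $H\leftarrow B$, where the head $H$ is an atom and the body $B$ is a query. A *moding* assigns $+$ (input) or $-$ (output) to each argument position of each predicate symbol; a *3-moding* assigns $+$, $-$ or $\bot$ (neutral). **Tidiness.** Let $M'$ be a moding. A query $Q=A_1,\dots,A_n$ is *tidy* under $M'$ if no variable occurs more than once in the output positions of $Q$ and the relation $\to_Q$ on $\{A_1,\dots,A_n\}$ is acyclic, where $A_i\to_Q A_j$ means that some variable occurs both in an output position of $A_i$ and in an input position of $A_j$. A clause $H\leftarrow B$ is *tidy* under $M'$ if $B$ is tidy, no variable occurs more than once in the input positions of $H$, and no variable from an input position of $H$ occurs in an output position of $B$. Let $M$ be a 3-moding. A program $P$ is *weakly tidy* under $M,M'$ if replacing, in each clause of $P$, the variables that occur in the $+$ positions (under $M$) of its head by ground terms yields a program all of whose clauses are tidy under $M'$. **Derivations.** SLD-derivations may use arbitrary most general unifiers (mgus) of the selected atom and the head of the input clause. Each input clause is a variant of a clause of the program, *standardized apart*: variable disjoint from the initial query and from the mgus and input clauses of the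 previous steps. A selection rule, given an initial fragment of a derivation, selects an occurrence of an atom in its last query or selects nothing. It is *compatible with $M$* for $P$ with $Q$ if, in all SLD-derivations for $P$ with $Q$ under the rule, the $+$ positions of each selected atom are ground, and some atom is selected in every nonempty query. The unification of $A$ and $H$ is *available* for $P$ with $Q$ if $A$ is the selected atom of a query of such a derivation and $H$ is the head of a standardized apart variant of a clause of $P$, with the same predicate symbol as $A$. **Unification.** The Martelli–Montanari algorithm repeatedly performs on a finite set of equations one of the following actions, on a nondeterministically chosen equation, until none applies: 1. replace $f(s_1,\dots,s_n)\doteq f(t_1,\dots,t_n)$ by $s_1\doteq t_1,\dots,s_n\doteq t_n$ (likewise for atoms with the same predicate symbol); 2. on $f(\dots)\doteq g(\dots)$ with $f\ne g$ (likewise for atoms with distinct predicate symbols), halt with failure; 3. delete $X\doteq X$; 4. replace $t\doteq X$, with $t$ not a variable, by $X\doteq t$; 5. on $X\doteq t$, with $X$ not occurring in $t$ but occurring in another equation, apply $\{X/t\}$ to all other equations; 6. on $X\doteq t$, with $X$ occurring in $t$ and $X\neq t$, halt with failure. A unification of $A$ and $H$ is *WNSTO* if there exists a run (a maximal sequence of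 actions) of the algorithm on $\{A\doteq H\}$ in which action 6 is not performed. $P$ with $Q$ is *weakly occur-check free* under a selection rule if every available unification is WNSTO. **Lemma.** Let $P$ be a program that is weakly tidy under a 3-moding $M$ and a moding $M'$, and let $Q$ be a query that is tidy under $M'$. Then, under any selection rule compatible with $M$ (for $P$ with $Q$), - each query in any SLD-derivation for $P$ with $Q$ is tidy under $M'$, and - $P$ with $Q$ is weakly occur-check free. -/

import Mathlib

/-! Logic programs over a first-order language `L` (function symbols `L.Functions`, predicate
symbols `L.Relations`) with variables from `V`. -/

namespace LP

universe u v w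

variable {L : FirstOrder.Language.{u, v}} {V : Type w}

/-! ### Syntax -/

/-- The variable occurrences of a term, from left to right. -/
def termVars : L.Term V → List V
  | .var x => [x]
  | .func _ ts => (List.ofFn fun i => termVars (ts i)).flatten

/-- A term is ground when no variable occurs in it. -/
def IsGround (t : L.Term V) : Prop := termVars t = []

/-- An atom `p(t₁, …, tₙ)`. -/
structure Atom (L : FirstOrder.Language.{u, v}) (V : Type w) where
  arity : ℕ
  pred : L.Relations arity
  args : Fin arity → L.Term V

/-- A query is a finite sequence of atoms. -/
abbrev Query (L : FirstOrder.Language.{u, v}) (V : Type w) := List (Atom L V)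

/-- A (definite) clause `head ← body`. -/
structure Clause (L : FirstOrder.Language.{u, v}) (V : Type w) where
  head : Atom L V
  body : Query L V

/-- Applying a map from variables to terms to an atom. -/
def Atom.subst (A : Atom L V) (σ : V → L.Term V) : Atom L V :=
  ⟨A.arity, A.pred, fun i => (A.args i).subst σ⟩

def Query.subst (Q : Query L V) (σ : V → L.Term V) : Query L V := Q.map fun A => A.subst σ

def Clause.subst (C : Clause L V) (σ : V → L.Term V) : Clause L V :=
  ⟨C.head.subst σ, Query.subst C.body σ⟩

/-- The set of variables of an atom. -/
def Atom.vars (A : Atom L V) : Set V := {x | ∃ i, x ∈ termVars (A.args i)}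

def Query.vars (Q : Query L V) : Set V := {x | ∃ A ∈ Q, x ∈ A.vars}

def Clause.vars (C : Clause L V) : Set V := C.head.vars ∪ Query.vars C.body

/-- Two atoms have the same predicate symbol. -/
def SamePred (A B : Atom L V) : Prop :=
  (⟨A.arity, A.pred⟩ : Σ n, L.Relations n) = ⟨B.arity, B.pred⟩

/-- `C'` is a variant of `C`: it is obtained by renaming the variables. -/
def Clause.IsVariant (C' C : Clause L V) : Prop :=
  ∃ π : Equiv.Perm V, C' = C.subst fun x => .var (π x)

/-- A substitution: a map from variables to terms with finite domain. -/
structure Subst (L : FirstOrder.Language.{u, v}) (V : Type w) where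
  toFun : V → L.Term V
  finite_dom : {x | toFun x ≠ .var x}.Finite

/-- `Dom(θ)`. -/
def Subst.dom (θ : Subst L V) : Set V := {x | θ.toFun x ≠ .var x}

/-- `Var(θ)`, i.e. the domain together with the variables of the terms assigned to it. -/
def Subst.vars (θ : Subst L V) : Set V :=
  θ.dom ∪ {y | ∃ x ∈ θ.dom, y ∈ termVars (θ.toFun x)}

def IsUnifier (θ : Subst L V) (A B : Atom L V) : Prop := A.subst θ.toFun = B.subst θ.toFun

/-- `θ` is a most general unifier: every unifier `η` is `θγ` for some substitution `γ`. -/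
def IsMGU (θ : Subst L V) (A B : Atom L V) : Prop :=
  IsUnifier θ A B ∧
    ∀ η : Subst L V, IsUnifier η A B →
      ∃ γ : Subst L V, ∀ x, η.toFun x = (θ.toFun x).subst γ.toFun

/-! ### Modings and tidiness -/

/-- The modes `+` (input) and `-` (output). -/
inductive Mode
  | input
  | output

/-- The modes of a 3-moding: `+`, `-` and `⊥` (neutral). -/
inductive Mode3
  | input
  | output
  | neutral

/-- A moding assigns `+` or `-` to each argument position of each predicate. -/
def Moding (L : FirstOrder.Language.{u, v}) := ∀ ⦃n : ℕ⦄, L.Relations n → Fin n → Mode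

/-- A 3-moding assigns `+`, `-` or `⊥` to each argument position of each predicate. -/
def Moding3 (L : FirstOrder.Language.{u, v}) := ∀ ⦃n : ℕ⦄, L.Relations n → Fin n → Mode3

open Classical in
/-- The variable occurrences in the argument positions of `A` that satisfy `s`. -/
noncomputable def Atom.varsAt (A : Atom L V) (s : Fin A.arity → Prop) : List V :=
  ((List.finRange A.arity).filter fun i => s i).flatMap fun i => termVars (A.args i)

/-- The variable occurrences in the input positions of an atom. -/
noncomputable def Atom.inVars (M : Moding L) (A : Atom L V) : List V :=
  A.varsAt fun i => M A.pred i = .input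

/-- The variable occurrences in the output positions of an atom. -/
noncomputable def Atom.outVars (M : Moding L) (A : Atom L V) : List V :=
  A.varsAt fun i => M A.pred i = .output

/-- An atom is input linear when no variable occurs twice in its input positions. -/
def Atom.InputLinear (M : Moding L) (A : Atom L V) : Prop := (A.inVars M).Nodup

/-- A query is output linear when no variable occurs twice in its output positions. -/
def Query.OutputLinear (M : Moding L) (Q : Query L V) : Prop :=
  (Q.flatMap fun A => A.outVars M).Nodup

/-- The relation `A →_Q B` on the atoms of `Q`: some variable occurs in an output position of `A`
and in an input position of `B`. -/
def Query.Arrow (M : Moding L) (Q : Query L V) (A B : Atom L V) : Prop :=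
  A ∈ Q ∧ B ∈ Q ∧ ∃ x, x ∈ A.outVars M ∧ x ∈ B.inVars M

/-- A query is tidy when it is output linear and `→_Q` is acyclic. -/
def Query.Tidy (M : Moding L) (Q : Query L V) : Prop :=
  Query.OutputLinear M Q ∧ ∀ A ∈ Q, ¬ Relation.TransGen (Query.Arrow M Q) A A

/-- A clause `H ← B` is tidy when `B` is tidy, `H` is input linear, and no variable from an input
position of `H` occurs in an output position of `B`. -/
def Clause.Tidy (M : Moding L) (C : Clause L V) : Prop :=
  Query.Tidy M C.body ∧ C.head.InputLinear M ∧
    ∀ x ∈ C.head.inVars M, ∀ A ∈ C.body, x ∉ A.outVars M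

/-- The variables occurring in the `+` positions of an atom, under a 3-moding. -/
def Atom.plusVars (M : Moding3 L) (A : Atom L V) : Set V :=
  {x | ∃ i, M A.pred i = .input ∧ x ∈ termVars (A.args i)}

/-- `γ` replaces by ground terms precisely the variables that occur in the `+` positions of the
head of `C`. -/
def Clause.IsGrounding (M : Moding3 L) (C : Clause L V) (γ : Subst L V) : Prop :=
  γ.dom = C.head.plusVars M ∧ ∀ x ∈ C.head.plusVars M, IsGround (γ.toFun x)

/-- `P` is weakly tidy under `M, M'`: grounding in each clause the variables that occur in the `+`
positions (under `M`) of its head results in a program which is tidy under `M'`. -/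
def WeaklyTidy (M : Moding3 L) (M' : Moding L) (P : Set (Clause L V)) : Prop :=
  ∀ C ∈ P, ∃ γ : Subst L V, C.IsGrounding M γ ∧ (C.subst γ.toFun).Tidy M'

/-! ### The Martelli-Montanari algorithm and WNSTO -/

/-- An equation between two terms or between two atoms. -/
inductive Equation (L : FirstOrder.Language.{u, v}) (V : Type w)
  | term (s t : L.Term V)
  | atom (A B : Atom L V)

def Equation.subst (σ : V → L.Term V) : Equation L V → Equation L V
  | .term s t => .term (s.subst σ) (t.subst σ)
  | .atom A B => .atom (A.subst σ) (B.subst σ)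

/-- The variable `x` occurs in the equation. -/
def Equation.Occurs (x : V) : Equation L V → Prop
  | .term s t => x ∈ termVars s ∨ x ∈ termVars t
  | .atom A B => x ∈ A.vars ∨ x ∈ B.vars

open Classical in
/-- The substitution `{x/t}`. -/
noncomputable def single (x : V) (t : L.Term V) : V → L.Term V :=
  fun y => if y = x then t else .var y

/-- The six actions of the algorithm. -/
inductive Action
  | decompose
  | clash
  | delete
  | swap
  | eliminate
  | occurCheck

/-- `Act a E S`: action `a`, performed on some equation of the set `E`, results in `S`, where
`S = none` means that the algorithm has halted with failure. -/
inductive Act : Action → Set (Equation L V) → Option (Set (Equation L V)) → Prop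
  /-- `f(s) ≐ f(t)` is replaced by the equations `sᵢ ≐ tᵢ`. -/
  | decompose {E : Set (Equation L V)} {n : ℕ} (f : L.Functions n) (s t : Fin n → L.Term V)
      (h : Equation.term (.func f s) (.func f t) ∈ E) :
      Act .decompose E
        (some (E \ {Equation.term (.func f s) (.func f t)} ∪
          Set.range fun i => Equation.term (s i) (t i)))
  /-- `p(s) ≐ p(t)` (atoms) is replaced by the equations `sᵢ ≐ tᵢ`. -/
  | decomposeAtom {E : Set (Equation L V)} {n : ℕ} (p : L.Relations n) (s t : Fin n → L.Term V)
      (h : Equation.atom ⟨n, p, s⟩ ⟨n, p, t⟩ ∈ E) :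
      Act .decompose E
        (some (E \ {Equation.atom ⟨n, p, s⟩ ⟨n, p, t⟩} ∪
          Set.range fun i => Equation.term (s i) (t i)))
  /-- `f(s) ≐ g(t)` with `f ≠ g`: halt with failure. -/
  | clash {E : Set (Equation L V)} {n m : ℕ} (f : L.Functions n) (g : L.Functions m)
      (s : Fin n → L.Term V) (t : Fin m → L.Term V)
      (hne : (⟨n, f⟩ : Σ k, L.Functions k) ≠ ⟨m, g⟩)
      (h : Equation.term (.func f s) (.func g t) ∈ E) :
      Act .clash E none
  /-- Two atoms with distinct predicate symbols: halt with failure. -/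
  | clashAtom {E : Set (Equation L V)} (A B : Atom L V) (hne : ¬ SamePred A B)
      (h : Equation.atom A B ∈ E) :
      Act .clash E none
  /-- `x ≐ x` is deleted. -/
  | delete {E : Set (Equation L V)} (x : V) (h : Equation.term (.var x) (.var x) ∈ E) :
      Act .delete E (some (E \ {Equation.term (.var x) (.var x)}))
  /-- `t ≐ x`, where `t` is not a variable, is replaced by `x ≐ t`. -/
  | swap {E : Set (Equation L V)} (t : L.Term V) (x : V) (ht : ∀ y, t ≠ .var y)
      (h : Equation.term t (.var x) ∈ E) :
      Act .swap E (some (E \ {Equation.term t (.var x)} ∪ {Equation.term (.var x) t}))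
  /-- `x ≐ t`, where `x` does not occur in `t` and occurs in another equation: `{x/t}` is applied to
  all the other equations. -/
  | eliminate {E : Set (Equation L V)} (x : V) (t : L.Term V) (hx : x ∉ termVars t)
      (h : Equation.term (.var x) t ∈ E)
      (hother : ∃ e ∈ E \ {Equation.term (.var x) t}, e.Occurs x) :
      Act .eliminate E
        (some (Equation.subst (single x t) '' (E \ {Equation.term (.var x) t}) ∪
          {Equation.term (.var x) t}))
  /-- `x ≐ t`, where `x` occurs in `t` and `x ≠ t`: halt with failure (the occur-check). -/
  | occurCheck {E : Set (Equation L V)} (x : V) (t : L.Term V) (hx : x ∈ termVars t)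
      (hne : t ≠ .var x) (h : Equation.term (.var x) t ∈ E) :
      Act .occurCheck E none

/-- `Run S as`: there is a run (a maximal sequence of actions) starting from the state `S` and
performing the actions `as`, in this order. -/
inductive Run : Option (Set (Equation L V)) → List Action → Prop
  | failed : Run none []
  | done (E : Set (Equation L V)) (h : ∀ a S, ¬ Act a E S) : Run (some E) []
  | act {E : Set (Equation L V)} {a : Action} {S : Option (Set (Equation L V))}
      {as : List Action} (h : Act a E S) (hr : Run S as) : Run (some E) (a :: as)

/-- An equation set is WNSTO when there is an occur-check free run of the algorithm for it, i.e.
a run in which the action `occurCheck` is not performed. -/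
def WNSTO (E : Set (Equation L V)) : Prop :=
  ∃ as : List Action, Run (some E) as ∧ Action.occurCheck ∉ as

/-! ### SLD-derivations -/

/-- A step of an SLD-derivation: the position of the selected atom, the input clause, the mgu, and
the resolvent obtained. -/
structure SLDStep (L : FirstOrder.Language.{u, v}) (V : Type w) where
  pos : ℕ
  clause : Clause L V
  mgu : Subst L V
  resolvent : Query L V

/-- The last query of a sequence of steps starting with the query `Q`. -/
def lastQuery (Q : Query L V) (ξ : List (SLDStep L V)) : Query L V :=
  (ξ.getLast?.map SLDStep.resolvent).getD Q

/-- The queries occurring in a derivation with initial query `Q` and steps `ξ`. -/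
def queries (Q : Query L V) (ξ : List (SLDStep L V)) : List (Query L V) :=
  Q :: ξ.map SLDStep.resolvent

/-- A (possibly partial) selection rule: given an initial fragment of a derivation (the initial
query and the steps performed so far), it selects an occurrence of an atom in the last query, or
selects nothing. -/
structure SelectionRule (L : FirstOrder.Language.{u, v}) (V : Type w) where
  select : Query L V → List (SLDStep L V) → Option ℕ
  valid : ∀ Q ξ i, select Q ξ = some i → i < (lastQuery Q ξ).length

/-- Under `R`, the atom `A`, at position `i` of the last query, is selected after the steps `ξ`. -/
def SelectionRule.Selects (R : SelectionRule L V) (Q : Query L V) (ξ : List (SLDStep L V))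
    (i : ℕ) (A : Atom L V) : Prop :=
  R.select Q ξ = some i ∧ (lastQuery Q ξ)[i]? = some A

/-- `c` is a variant of a clause of `P`, standardized apart: it is variable disjoint from the
initial query and from the input clauses and the mgus of the previous steps. -/
def StandardizedApart (P : Set (Clause L V)) (Q : Query L V) (ξ : List (SLDStep L V))
    (c : Clause L V) : Prop :=
  (∃ C ∈ P, c.IsVariant C) ∧ Disjoint c.vars (Query.vars Q) ∧
    ∀ st ∈ ξ, Disjoint c.vars st.clause.vars ∧ Disjoint c.vars st.mgu.vars

/-- `ξ` is (the sequence of the steps of) a finite initial fragment of an SLD-derivation for `P`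
with `Q` under the selection rule `R`. Any mgus are allowed. A (finite or infinite) SLD-derivation
consists of the queries of its finite initial fragments, and the branches of SLD-trees under `R` are
the SLD-derivations under `R`. -/
inductive SLDDerivation (P : Set (Clause L V)) (R : SelectionRule L V) (Q : Query L V) :
    List (SLDStep L V) → Prop
  | nil : SLDDerivation P R Q []
  | step {ξ : List (SLDStep L V)} (h : SLDDerivation P R Q ξ) {i : ℕ} {A : Atom L V}
      (hA : R.Selects Q ξ i A) {c : Clause L V} (hc : StandardizedApart P Q ξ c)
      {θ : Subst L V} (hθ : IsMGU θ A c.head) :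
      SLDDerivation P R Q
        (ξ ++ [⟨i, c, θ, Query.subst
          ((lastQuery Q ξ).take i ++ c.body ++ (lastQuery Q ξ).drop (i + 1)) θ.toFun⟩])

/-- `R` is compatible with the 3-moding `M` for `P` with `Q`: in each SLD-derivation, the `+`
positions of each selected atom are ground, and some atom is selected in every nonempty query. -/
def SelectionRule.Compatible (R : SelectionRule L V) (M : Moding3 L) (P : Set (Clause L V))
    (Q : Query L V) : Prop :=
  ∀ ξ, SLDDerivation P R Q ξ →
    (∀ i A, R.Selects Q ξ i A → ∀ j, M A.pred j = .input → IsGround (A.args j)) ∧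
    (lastQuery Q ξ ≠ [] → ∃ i A, R.Selects Q ξ i A)

/-- The unification of `A` and `H` is available for `P` with `Q` under `R`: `A` is the selected
atom of a query of an SLD-derivation, and `H`, with the same predicate symbol, is a standardized
apart head of a clause of `P`. -/
def Available (P : Set (Clause L V)) (R : SelectionRule L V) (Q : Query L V)
    (A H : Atom L V) : Prop :=
  ∃ ξ, SLDDerivation P R Q ξ ∧ (∃ i, R.Selects Q ξ i A) ∧
    (∃ c, StandardizedApart P Q ξ c ∧ c.head = H) ∧ SamePred A H

/-- `P` with `Q` is weakly occur-check free under `R`. -/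
def WeaklyOccurCheckFree (P : Set (Clause L V)) (R : SelectionRule L V) (Q : Query L V) : Prop :=
  ∀ A H, Available P R Q A H → WNSTO {Equation.atom A H}

end LP

/-! Tidiness depends only on the variable occurrences in input and output positions, so each atom is
reduced to an item, a pair of lists of variables. Since a finite acyclic relation extends to a
linear order, a query is tidy exactly when its items can be listed so that outputs are linear and no
input variable is output at the same place or later (`query_tidy_iff`).

An equation is an item too, once one side is called the input. To resolve `p(s)` against a head
`p(t)`, orient the equation of an input position from `s i` to `t i`, and that of an output position
from `t i` to `s i`: the inputs of the head receive values from the query, and its outputs deliver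
values to the query. If the clause is tidy and standardized apart, the equations, the body and the
rest of the query together form a tidy list (`NicelyModed.resolve`). In a tidy list the two sides of
an equation share no variable, so an equation with a variable as one side never needs the
occur-check. Decomposing an equation, or eliminating a variable by it, keeps the list tidy
(`TidyItems.decompose`, `TidyItems.eliminate`), and terminates. Hence the whole system is solved or
clashes without occur-check, and on success the instantiated resolvent is what remains of the tidy
list (`exists_solve_of_tidyItems`).

A weakly tidy clause is tidy only after its `+` variables are grounded. The selected atom is ground
at its `+` positions, so the corresponding equations, solved first, bind exactly these variables to
ground terms; for the remaining items this amounts to deleting those variables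
(`exists_solve_of_isGround`).

The predicate `Solve` records such a strategy. It yields both a run of the algorithm
(`Solve.exists_run`) and a most general unifier (`Solve.exists_mgu`). An arbitrary mgu differs from
that one by an injective renaming on the variables that matter, and renamings preserve tidiness
(`tidy_resolvent`). Induction along the derivation finishes the proof. -/

namespace LP

universe u v w

variable {L : FirstOrder.Language.{u, v}} {V : Type w}

/-! ### Tidy lists of items -/

/-- The input and the output variable occurrences of an atom or of an oriented equation. -/
abbrev Item (V : Type w) := List V × List V

/-- Replacing each variable `x` of an item by the variables `f x`. -/
def Item.bind (f : V → List V) (a : Item V) : Item V := (a.1.flatMap f, a.2.flatMap f)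

/-- No variable has two output occurrences, and each input occurrence of a variable comes after its
output occurrence. -/
def NicelyModed (D : List (Item V)) : Prop :=
  (∀ a ∈ D, a.2.Nodup ∧ a.1.Disjoint a.2) ∧
    D.Pairwise fun a b => a.2.Disjoint b.2 ∧ a.1.Disjoint b.2

/-- Some permutation is nicely moded. -/
def TidyItems (D : List (Item V)) : Prop := ∃ D', D'.Perm D ∧ NicelyModed D'

theorem Item.bind_bind (f g : V → List V) (a : Item V) :
    Item.bind g (Item.bind f a) = Item.bind (fun x => (f x).flatMap g) a := by
  simp [Item.bind, List.flatMap_assoc]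

theorem flatMap_eq_self {l : List V} {f : V → List V} (h : ∀ x ∈ l, f x = [x]) :
    l.flatMap f = l := by
  induction l with
  | nil => rfl
  | cons a l ih =>
    rw [List.flatMap_cons, h a (by simp), ih fun x hx => h x (by simp [hx])]
    rfl

theorem Item.bind_eq_self {a : Item V} {f : V → List V} (h : ∀ x, x ∈ a.1 ∨ x ∈ a.2 → f x = [x]) :
    Item.bind f a = a := by
  rw [Item.bind, flatMap_eq_self fun x hx => h x (.inl hx),
    flatMap_eq_self fun x hx => h x (.inr hx)]

theorem nodup_flatMap_of {l : List V} {f : V → List V} (hl : l.Nodup)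
    (hf : ∀ x ∈ l, (f x).Nodup) (hd : ∀ x ∈ l, ∀ y ∈ l, x ≠ y → (f x).Disjoint (f y)) :
    (l.flatMap f).Nodup := by
  refine List.nodup_flatMap.2 ⟨hf, ?_⟩
  exact List.Pairwise.imp_of_mem (fun ha hb hab => hd _ ha _ hb hab) hl

theorem NicelyModed.sublist {D D' : List (Item V)} (h : NicelyModed D) (hs : D'.Sublist D) :
    NicelyModed D' :=
  ⟨fun a ha => h.1 a (hs.subset ha), h.2.sublist hs⟩

theorem TidyItems.sublist {D D' : List (Item V)} (h : TidyItems D) (hs : D'.Sublist D) :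
    TidyItems D' := by
  obtain ⟨D₁, hp, hn⟩ := h
  obtain ⟨D₂, hp₂, hs₂⟩ := List.exists_perm_sublist hs hp.symm
  exact ⟨D₂, hp₂, hn.sublist hs₂⟩

theorem TidyItems.perm {D D' : List (Item V)} (h : TidyItems D) (hs : D.Perm D') :
    TidyItems D' := by
  obtain ⟨D₁, hp, hn⟩ := h
  exact ⟨D₁, hp.trans hs, hn⟩

theorem TidyItems.exists_split {a : Item V} {D : List (Item V)} (h : TidyItems (a :: D)) :
    ∃ D₁ D₂, (D₁ ++ D₂).Perm D ∧ NicelyModed (D₁ ++ a :: D₂) := by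
  obtain ⟨D', hp, hn⟩ := h
  obtain ⟨D₁, D₂, rfl⟩ := List.append_of_mem (hp.symm.subset (List.mem_cons_self : a ∈ a :: D))
  exact ⟨D₁, D₂, (List.perm_cons a).1 (List.perm_middle.symm.trans hp), hn⟩

/-- Isolates the constraints that involve one distinguished item, which is later decomposed,
eliminated or resolved upon. -/
theorem nicelyModed_split {D₁ D₂ : List (Item V)} {a : Item V} :
    NicelyModed (D₁ ++ a :: D₂) ↔
      NicelyModed D₁ ∧ NicelyModed D₂ ∧ a.2.Nodup ∧ a.1.Disjoint a.2 ∧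
      (∀ b ∈ D₁, b.2.Disjoint a.2 ∧ b.1.Disjoint a.2) ∧
      (∀ c ∈ D₂, a.2.Disjoint c.2 ∧ a.1.Disjoint c.2) ∧
      ∀ b ∈ D₁, ∀ c ∈ D₂, b.2.Disjoint c.2 ∧ b.1.Disjoint c.2 := by
  simp only [NicelyModed, List.pairwise_append, List.pairwise_cons, List.mem_append, List.mem_cons]
  constructor
  · rintro ⟨h₁, h₂, ⟨h₃, h₄⟩, h₅⟩
    exact ⟨⟨fun b hb => h₁ b (.inl hb), h₂⟩, ⟨fun b hb => h₁ b (.inr (.inr hb)), h₄⟩,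
      (h₁ a (.inr (.inl rfl))).1, (h₁ a (.inr (.inl rfl))).2, fun b hb => h₅ b hb a (.inl rfl), h₃,
      fun b hb c hc => h₅ b hb c (.inr hc)⟩
  · rintro ⟨⟨h₁, h₂⟩, ⟨h₃, h₄⟩, h₅, h₆, h₇, h₈, h₉⟩
    refine ⟨?_, h₂, ⟨h₈, h₄⟩, ?_⟩
    · rintro b (hb | rfl | hb)
      exacts [h₁ b hb, ⟨h₅, h₆⟩, h₃ b hb]
    · rintro b hb c (rfl | hc)
      exacts [h₇ b hb, h₉ b hb c hc]

theorem nicelyModed_append {D₁ D₂ : List (Item V)} :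
    NicelyModed (D₁ ++ D₂) ↔ NicelyModed D₁ ∧ NicelyModed D₂ ∧
      ∀ b ∈ D₁, ∀ c ∈ D₂, b.2.Disjoint c.2 ∧ b.1.Disjoint c.2 := by
  simp only [NicelyModed, List.pairwise_append, List.mem_append]
  constructor
  · rintro ⟨h₁, h₂, h₃, h₄⟩
    exact ⟨⟨fun b hb => h₁ b (.inl hb), h₂⟩, ⟨fun b hb => h₁ b (.inr hb), h₃⟩, h₄⟩
  · rintro ⟨⟨h₁, h₂⟩, ⟨h₃, h₄⟩, h₅⟩
    exact ⟨fun b hb => hb.elim (h₁ b) (h₃ b), h₂, h₄, h₅⟩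

/-- An item may be decomposed. -/
theorem NicelyModed.decompose {ι : Type*} {D₁ D₂ : List (Item V)} {l : List ι} {f g : ι → List V}
    (h : NicelyModed (D₁ ++ (l.flatMap f, l.flatMap g) :: D₂)) :
    NicelyModed (D₁ ++ (l.map (fun i => (f i, g i)) ++ D₂)) := by
  obtain ⟨h₁, h₂, h₃, h₄, h₅, h₆, h₇⟩ := nicelyModed_split.1 h
  simp only [List.Disjoint, List.mem_flatMap] at h₄ h₅ h₆ h₇
  rw [List.nodup_flatMap] at h₃
  have hmid : NicelyModed (l.map (fun i => (f i, g i))) := by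
    refine ⟨?_, ?_⟩
    · simp only [List.mem_map]
      rintro _ ⟨i, hi, rfl⟩
      exact ⟨h₃.1 i hi, fun x hx hx' => h₄ ⟨i, hi, hx⟩ ⟨i, hi, hx'⟩⟩
    · rw [List.pairwise_map]
      exact List.Pairwise.imp_of_mem (fun {i j} hi hj hij =>
        ⟨hij, fun x hx hx' => h₄ ⟨i, hi, hx⟩ ⟨j, hj, hx'⟩⟩) h₃.2
  rw [nicelyModed_append, nicelyModed_append]
  refine ⟨h₁, ⟨hmid, h₂, ?_⟩, ?_⟩
  · simp only [List.mem_map]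
    rintro _ ⟨i, hi, rfl⟩ c hc
    exact ⟨fun x hx => (h₆ c hc).1 ⟨i, hi, hx⟩, fun x hx => (h₆ c hc).2 ⟨i, hi, hx⟩⟩
  · simp only [List.mem_append, List.mem_map]
    rintro b hb _ (⟨i, hi, rfl⟩ | hc)
    · exact ⟨fun x hx hx' => (h₅ b hb).1 hx ⟨i, hi, hx'⟩,
        fun x hx hx' => (h₅ b hb).2 hx ⟨i, hi, hx'⟩⟩
    · exact h₇ b hb _ hc

theorem TidyItems.decompose {ι : Type*} {D : List (Item V)} {l : List ι} {f g : ι → List V}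
    (h : TidyItems ((l.flatMap f, l.flatMap g) :: D)) :
    TidyItems (l.map (fun i => (f i, g i)) ++ D) := by
  obtain ⟨D₁, D₂, hp, hn⟩ := h.exists_split
  refine ⟨_, ?_, hn.decompose⟩
  exact (List.perm_append_comm_assoc _ _ _).trans (hp.append_left _)

open Classical in
/-- The map that replaces the variable `x` by the variables `l`. -/
noncomputable def repl (x : V) (l : List V) (y : V) : List V := if y = x then l else [y]

theorem mem_flatMap_repl {x y : V} {w l : List V} :
    y ∈ l.flatMap (repl x w) ↔ (y ∈ l ∧ y ≠ x) ∨ (x ∈ l ∧ y ∈ w) := by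
  simp only [List.mem_flatMap, repl]
  constructor
  · rintro ⟨z, hz, hy⟩
    split_ifs at hy with h
    · exact .inr ⟨h ▸ hz, hy⟩
    · rw [List.mem_singleton] at hy
      subst hy
      exact .inl ⟨hz, h⟩
  · rintro (⟨hy, hne⟩ | ⟨hx, hy⟩)
    · exact ⟨y, hy, by simp [hne]⟩
    · exact ⟨x, hx, by simp [hy]⟩

theorem flatMap_repl_of_notMem {x : V} {w l : List V} (h : x ∉ l) : l.flatMap (repl x w) = l :=
  flatMap_eq_self fun y hy => if_neg fun e : y = x => h (e ▸ hy)

theorem nodup_flatMap_repl {x : V} {w l : List V} (hl : l.Nodup) (hw : w.Nodup)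
    (h : l.Disjoint w) : (l.flatMap (repl x w)).Nodup := by
  refine nodup_flatMap_of hl ?_ ?_
  · intro y _
    unfold repl
    split_ifs
    exacts [hw, List.nodup_singleton y]
  · intro y hy z hz hne
    unfold repl
    split_ifs with h₁ h₂ h₂
    · exact absurd (h₁.trans h₂.symm) hne
    · simpa using h hz
    · simpa using h hy
    · simpa using hne.symm

/-- The output variable `x` cannot occur in earlier items at all, nor in outputs of later ones. Only
inputs of later items change, and there `w` is harmless, since its variables, being inputs of the
removed item, are not output later. The order can be kept. -/
theorem NicelyModed.eliminate_output {D₁ D₂ : List (Item V)} {x : V} {w : List V}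
    (h : NicelyModed (D₁ ++ (w, [x]) :: D₂)) :
    NicelyModed ((D₁ ++ D₂).map (Item.bind (repl x w))) := by
  obtain ⟨h₁, h₂, -, h₄, h₅, h₆, h₇⟩ := nicelyModed_split.1 h
  simp only [List.disjoint_singleton, List.singleton_disjoint] at h₄ h₅ h₆
  have e₁ : D₁.map (Item.bind (repl x w)) = D₁ := by
    refine (List.map_congr_left fun a ha => ?_).trans (List.map_id _)
    exact Prod.ext (flatMap_repl_of_notMem (h₅ a ha).2) (flatMap_repl_of_notMem (h₅ a ha).1)
  have e₂ : ∀ a ∈ D₂, (Item.bind (repl x w) a).2 = a.2 := fun a ha =>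
    flatMap_repl_of_notMem (h₆ a ha).1
  have e₃ : ∀ a, ∀ y ∈ (Item.bind (repl x w) a).1, y ∈ a.1 ∨ y ∈ w := fun a y hy =>
    (mem_flatMap_repl.1 hy).imp And.left And.right
  rw [List.map_append, e₁, nicelyModed_append]
  refine ⟨h₁, ⟨?_, ?_⟩, ?_⟩
  · simp only [List.mem_map]
    rintro _ ⟨a, ha, rfl⟩
    rw [e₂ a ha]
    refine ⟨(h₂.1 a ha).1, fun y hy hy' => ?_⟩
    exact (e₃ a y hy).elim (fun hy => (h₂.1 a ha).2 hy hy') (fun hy => (h₆ a ha).2 hy hy')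
  · rw [List.pairwise_map]
    refine List.Pairwise.imp_of_mem (fun {a b} ha hb hab => ?_) h₂.2
    rw [e₂ a ha, e₂ b hb]
    refine ⟨hab.1, fun y hy hy' => ?_⟩
    exact (e₃ a y hy).elim (fun hy => hab.2 hy hy') (fun hy => (h₆ b hb).2 hy hy')
  · simp only [List.mem_map]
    rintro b hb _ ⟨a, ha, rfl⟩
    rw [e₂ a ha]
    exact h₇ b hb a ha

/-- The variable `x` may be output by one earlier item, which then outputs `w` instead. This is safe
since `w` is linear and its variables occur nowhere earlier. Outputs of later items contain neither
`x` nor variables of `w`, so again the order can be kept. -/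
theorem NicelyModed.eliminate_input {D₁ D₂ : List (Item V)} {x : V} {w : List V}
    (h : NicelyModed (D₁ ++ ([x], w) :: D₂)) :
    NicelyModed ((D₁ ++ D₂).map (Item.bind (repl x w))) := by
  obtain ⟨h₁, h₂, h₃, h₄, h₅, h₆, h₇⟩ := nicelyModed_split.1 h
  simp only [List.singleton_disjoint] at h₄ h₆
  have e₂ : ∀ a ∈ D₂, (Item.bind (repl x w) a).2 = a.2 := fun a ha =>
    flatMap_repl_of_notMem (h₆ a ha).2
  have key : ∀ a ∈ D₁, ∀ l : List V, l.Disjoint a.2 → l.Disjoint w →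
      (l.flatMap (repl x w)).Disjoint (a.2.flatMap (repl x w)) := by
    intro a ha l hl hw y hy hy'
    rw [mem_flatMap_repl] at hy hy'
    rcases hy with ⟨hy, -⟩ | ⟨hx, hy⟩ <;> rcases hy' with ⟨hy', -⟩ | ⟨hx', hy'⟩
    exacts [hl hy hy', hw hy hy', (h₅ a ha).1 hy' hy, hl hx hx']
  have key₂ : ∀ b ∈ D₂, ∀ l : List V, l.Disjoint b.2 →
      (l.flatMap (repl x w)).Disjoint b.2 := by
    intro b hb l hl y hy hy'
    rcases mem_flatMap_repl.1 hy with ⟨hy, -⟩ | ⟨hx, hy⟩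
    exacts [hl hy hy', (h₆ b hb).1 hy hy']
  rw [List.map_append, nicelyModed_append]
  refine ⟨⟨?_, ?_⟩, ⟨?_, ?_⟩, ?_⟩
  · simp only [List.mem_map]
    rintro _ ⟨a, ha, rfl⟩
    exact ⟨nodup_flatMap_repl (h₁.1 a ha).1 h₃ (h₅ a ha).1,
      key a ha _ (h₁.1 a ha).2 (h₅ a ha).2⟩
  · rw [List.pairwise_map]
    exact List.Pairwise.imp_of_mem (fun {a b} ha hb hab =>
      ⟨key b hb _ hab.1 (h₅ a ha).1, key b hb _ hab.2 (h₅ a ha).2⟩) h₁.2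
  · simp only [List.mem_map]
    rintro _ ⟨a, ha, rfl⟩
    rw [e₂ a ha]
    exact ⟨(h₂.1 a ha).1, key₂ a ha _ (h₂.1 a ha).2⟩
  · rw [List.pairwise_map]
    refine List.Pairwise.imp_of_mem (fun {a b} ha hb hab => ?_) h₂.2
    rw [e₂ b hb]
    exact ⟨key₂ b hb _ hab.1, key₂ b hb _ hab.2⟩
  · simp only [List.mem_map]
    rintro _ ⟨b, hb, rfl⟩ _ ⟨a, ha, rfl⟩
    rw [e₂ a ha]
    exact ⟨key₂ a ha _ (h₇ b hb a ha).1, key₂ a ha _ (h₇ b hb a ha).2⟩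

/-- A variable that is the input or the output of an item may be eliminated. -/
theorem TidyItems.eliminate {D : List (Item V)} {x : V} {w : List V}
    (h : TidyItems (([x], w) :: D) ∨ TidyItems ((w, [x]) :: D)) :
    x ∉ w ∧ TidyItems (D.map (Item.bind (repl x w))) := by
  rcases h with h | h <;> obtain ⟨D₁, D₂, hp, hn⟩ := h.exists_split
  · exact ⟨by simpa using (nicelyModed_split.1 hn).2.2.2.1, _, hp.map _, hn.eliminate_input⟩
  · exact ⟨by simpa using (nicelyModed_split.1 hn).2.2.2.1, _, hp.map _, hn.eliminate_output⟩

/-- Meant for injective renamings; the conditions on `f` are only needed for variables that occur in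
`D`, since an mgu acts as a renaming only there. -/
theorem NicelyModed.map_bind {D : List (Item V)} {f : V → List V} (h : NicelyModed D)
    (hf : ∀ a ∈ D, ∀ x, x ∈ a.1 ∨ x ∈ a.2 → (f x).Nodup)
    (hd : ∀ a ∈ D, ∀ b ∈ D, ∀ x y, x ∈ a.1 ∨ x ∈ a.2 → y ∈ b.1 ∨ y ∈ b.2 → x ≠ y →
      (f x).Disjoint (f y)) :
    NicelyModed (D.map (Item.bind f)) := by
  have key : ∀ a ∈ D, ∀ b ∈ D, (a.2.Disjoint b.2 → (a.2.flatMap f).Disjoint (b.2.flatMap f)) ∧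
      (a.1.Disjoint b.2 → (a.1.flatMap f).Disjoint (b.2.flatMap f)) := by
    intro a ha b hb
    constructor <;> intro hab y hy hy' <;> rw [List.mem_flatMap] at hy hy' <;>
      obtain ⟨z, hz, hy⟩ := hy <;> obtain ⟨z', hz', hy'⟩ := hy'
    · exact hd a ha b hb z z' (.inr hz) (.inr hz') (fun e => hab hz (e ▸ hz')) hy hy'
    · exact hd a ha b hb z z' (.inl hz) (.inr hz') (fun e => hab hz (e ▸ hz')) hy hy'
  refine ⟨?_, ?_⟩
  · simp only [List.mem_map]
    rintro _ ⟨a, ha, rfl⟩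
    exact ⟨nodup_flatMap_of (h.1 a ha).1 (fun x hx => hf a ha x (.inr hx)) fun x hx y hy =>
      hd a ha a ha x y (.inr hx) (.inr hy), (key a ha a ha).2 (h.1 a ha).2⟩
  · rw [List.pairwise_map]
    exact List.Pairwise.imp_of_mem (fun {a b} ha hb hab =>
      ⟨(key a ha b hb).1 hab.1, (key a ha b hb).2 hab.2⟩) h.2

theorem TidyItems.map_bind {D : List (Item V)} {f : V → List V} (h : TidyItems D)
    (hf : ∀ a ∈ D, ∀ x, x ∈ a.1 ∨ x ∈ a.2 → (f x).Nodup)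
    (hd : ∀ a ∈ D, ∀ b ∈ D, ∀ x y, x ∈ a.1 ∨ x ∈ a.2 → y ∈ b.1 ∨ y ∈ b.2 → x ≠ y →
      (f x).Disjoint (f y)) :
    TidyItems (D.map (Item.bind f)) := by
  obtain ⟨D', hp, hn⟩ := h
  exact ⟨_, hp.map _, hn.map_bind (fun a ha => hf a (hp.subset ha)) fun a ha b hb =>
    hd a (hp.subset ha) b (hp.subset hb)⟩

/-- The items obtained by resolving a nicely moded query with a nicely moded clause. -/
theorem NicelyModed.resolve {D₁ D₂ B : List (Item V)} {i o hi ho : List V} {p : V → Prop}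
    (hQ : NicelyModed (D₁ ++ (i, o) :: D₂)) (hC : NicelyModed (([], hi) :: B))
    (hQp : ∀ a ∈ D₁ ++ (i, o) :: D₂, ∀ x, x ∈ a.1 ∨ x ∈ a.2 → p x)
    (hCp : ∀ a ∈ ([], hi) :: B, ∀ x, x ∈ a.1 ∨ x ∈ a.2 → ¬ p x) (hop : ∀ x ∈ ho, ¬ p x) :
    NicelyModed (D₁ ++ (i, hi) :: (B ++ (ho, o) :: D₂)) := by
  obtain ⟨h₁, h₂, h₃, h₄, h₅, h₆, h₇⟩ := nicelyModed_split.1 hQ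
  obtain ⟨-, k₂, k₃, -, -, k₆, -⟩ := nicelyModed_split (D₁ := []) |>.1 hC
  simp only [List.mem_append, List.mem_cons] at hQp hCp
  have p₁ : ∀ a ∈ D₁, ∀ x, x ∈ a.1 ∨ x ∈ a.2 → p x := fun a ha => hQp a (.inl ha)
  have p₂ : ∀ a ∈ D₂, ∀ x, x ∈ a.1 ∨ x ∈ a.2 → p x := fun a ha => hQp a (.inr (.inr ha))
  have p₃ : ∀ x ∈ i, p x := fun x hx => hQp (i, o) (.inr (.inl rfl)) x (.inl hx)
  have p₄ : ∀ x ∈ o, p x := fun x hx => hQp (i, o) (.inr (.inl rfl)) x (.inr hx)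
  have q₁ : ∀ a ∈ B, ∀ x, x ∈ a.1 ∨ x ∈ a.2 → ¬ p x := fun a ha => hCp a (.inr ha)
  have q₂ : ∀ x ∈ hi, ¬ p x := fun x hx => hCp ([], hi) (.inl rfl) x (.inr hx)
  have r₁ : NicelyModed (B ++ (ho, o) :: D₂) := by
    refine nicelyModed_split.2 ⟨k₂, h₂, h₃, fun x hx hx' => hop x hx (p₄ x hx'), ?_, ?_, ?_⟩
    · exact fun b hb => ⟨fun x hx hx' => q₁ b hb x (.inr hx) (p₄ x hx'),
        fun x hx hx' => q₁ b hb x (.inl hx) (p₄ x hx')⟩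
    · exact fun c hc => ⟨(h₆ c hc).1, fun x hx hx' => hop x hx (p₂ c hc x (.inr hx'))⟩
    · exact fun b hb c hc => ⟨fun x hx hx' => q₁ b hb x (.inr hx) (p₂ c hc x (.inr hx')),
        fun x hx hx' => q₁ b hb x (.inl hx) (p₂ c hc x (.inr hx'))⟩
  refine nicelyModed_split.2 ⟨h₁, r₁, k₃, fun x hx hx' => q₂ x hx' (p₃ x hx), ?_, ?_, ?_⟩
  · exact fun b hb => ⟨fun x hx hx' => q₂ x hx' (p₁ b hb x (.inr hx)),
      fun x hx hx' => q₂ x hx' (p₁ b hb x (.inl hx))⟩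
  · simp only [List.mem_append, List.mem_cons]
    rintro c (hc | rfl | hc)
    · exact ⟨(k₆ c hc).1, fun x hx hx' => q₁ c hc x (.inr hx') (p₃ x hx)⟩
    · exact ⟨fun x hx hx' => q₂ x hx (p₄ x hx'), h₄⟩
    · exact ⟨fun x hx hx' => q₂ x hx (p₂ c hc x (.inr hx')), (h₆ c hc).2⟩
  · simp only [List.mem_append, List.mem_cons]
    rintro b hb c (hc | rfl | hc)
    · exact ⟨fun x hx hx' => q₁ c hc x (.inr hx') (p₁ b hb x (.inr hx)),
        fun x hx hx' => q₁ c hc x (.inr hx') (p₁ b hb x (.inl hx))⟩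
    · exact h₅ b hb
    · exact h₇ b hb c hc

/-! ### Items of queries -/

/-- The item of an atom. -/
noncomputable def Atom.item (M : Moding L) (A : Atom L V) : Item V := (A.inVars M, A.outVars M)

/-- The reflexive transitive closure of an acyclic relation is a partial order; extend it to a
linear order and sort by it. Repeated elements cause no trouble, as acyclicity excludes `r a a`. -/
theorem exists_perm_pairwise_of_acyclic {α : Type*} (r : α → α → Prop)
    (h : ∀ a, ¬ Relation.TransGen r a a) (l : List α) :
    ∃ l' : List α, l'.Perm l ∧ l'.Pairwise fun a b => ¬ r b a := by
  classical
  have : IsPartialOrder α (Relation.ReflTransGen r) :=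
    { refl := fun a => Relation.ReflTransGen.refl
      trans := fun a b c => Relation.ReflTransGen.trans
      antisymm := fun a b hab hba => by
        rcases Relation.reflTransGen_iff_eq_or_transGen.1 hab with e | hab
        · exact e.symm
        · exact absurd (hab.trans_left hba) (h a) }
  obtain ⟨s, hs, hrs⟩ := extend_partialOrder (Relation.ReflTransGen r)
  refine ⟨l.insertionSort s, List.perm_insertionSort s l, ?_⟩
  refine (List.pairwise_insertionSort s l).imp fun {a b} hab hba => ?_
  have e : a = b := hs.antisymm _ _ hab (hrs _ _ (Relation.ReflTransGen.single hba))
  subst e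
  exact h a (Relation.TransGen.single hba)

theorem Query.Tidy.exists_nicelyModed {M : Moding L} {Q : Query L V} (h : Query.Tidy M Q) :
    ∃ Q' : Query L V, Q'.Perm Q ∧ NicelyModed (Q'.map (Atom.item M)) := by
  have hac : ∀ A, ¬ Relation.TransGen (Query.Arrow M Q) A A := by
    intro A hA
    obtain ⟨B, hB, -⟩ := Relation.TransGen.head'_iff.1 hA
    exact h.2 A hB.1 hA
  obtain ⟨Q', hp, hQ'⟩ := exists_perm_pairwise_of_acyclic _ hac Q
  have hlin : (Q'.flatMap fun A => A.outVars M).Nodup :=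
    (List.Perm.nodup_iff (hp.flatMap_right _)).2 h.1
  rw [List.nodup_flatMap] at hlin
  refine ⟨Q', hp, ?_, ?_⟩
  · simp only [List.mem_map]
    rintro _ ⟨A, hA, rfl⟩
    refine ⟨hlin.1 A hA, fun x hx hx' => hac A (.single ?_)⟩
    exact ⟨hp.subset hA, hp.subset hA, x, hx', hx⟩
  · rw [List.pairwise_map]
    refine List.Pairwise.imp_of_mem (fun {A B} hA hB hAB => ?_) (hlin.2.and hQ')
    exact ⟨hAB.1, fun x hx hx' => hAB.2 ⟨hp.subset hB, hp.subset hA, x, hx', hx⟩⟩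

theorem query_tidy_iff {M : Moding L} {Q : Query L V} :
    Query.Tidy M Q ↔ TidyItems (Q.map (Atom.item M)) := by
  constructor
  · intro h
    obtain ⟨Q', hp, hn⟩ := h.exists_nicelyModed
    exact ⟨_, hp.map _, hn⟩
  · rintro ⟨D, hp, hn⟩
    constructor
    · have e : (Q.flatMap fun A => A.outVars M) = (Q.map (Atom.item M)).flatMap Prod.snd := by
        rw [List.flatMap_map]
        rfl
      rw [Query.OutputLinear, e]
      refine (List.Perm.nodup_iff (hp.flatMap_right _)).1 (List.nodup_flatMap.2 ⟨?_, ?_⟩)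
      · exact fun a ha => (hn.1 a ha).1
      · exact hn.2.imp fun hab => hab.1
    -- Arrows strictly increase positions in `D`. The arrow relates atoms rather than occurrences,
    -- so the claim covers every pair of positions carrying the two items; a cycle then gives `k <
    -- k`.
    · have key : ∀ A B, Relation.TransGen (Query.Arrow M Q) A B →
          ∀ i j : Fin D.length, D.get i = A.item M → D.get j = B.item M → i < j := by
        have base : ∀ A B, Query.Arrow M Q A B →
            ∀ i j : Fin D.length, D.get i = A.item M → D.get j = B.item M → i < j := by
          rintro A B ⟨hA, hB, x, hx, hx'⟩ i j hi hj
          by_contra hij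
          rcases (not_lt.1 hij).eq_or_lt with e | hlt
          · subst e
            have := (hn.1 _ (List.get_mem D j)).2
            exact this (a := x) (by rw [hj]; exact hx') (by rw [hi]; exact hx)
          · have := List.pairwise_iff_get.1 hn.2 j i hlt
            rw [hi, hj] at this
            exact this.2 hx' hx
        intro A B hAB
        induction hAB with
        | single h => exact base _ _ h
        | @tail B C _ h ih =>
          intro i j hi hj
          obtain ⟨k, hk⟩ := List.mem_iff_get.1 (hp.symm.subset (List.mem_map_of_mem h.1))
          exact (ih i k hi hk).trans (base _ _ h k j hk hj)
      intro A hA hAA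
      obtain ⟨k, hk⟩ := List.mem_iff_get.1 (hp.symm.subset (List.mem_map_of_mem hA))
      exact lt_irrefl _ (key A A hAA k k hk hk)

/-! ### Terms and substitutions -/

@[simp]
theorem termVars_var (x : V) : termVars (.var x : L.Term V) = [x] := by
  rw [termVars]

theorem mem_termVars_func {n : ℕ} {f : L.Functions n} {ts : Fin n → L.Term V} {x : V} :
    x ∈ termVars (.func f ts) ↔ ∃ i, x ∈ termVars (ts i) := by
  rw [termVars]
  simp [List.mem_flatten, List.mem_ofFn]

theorem termVars_func_eq {n : ℕ} (f : L.Functions n) (ts : Fin n → L.Term V) :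
    termVars (.func f ts) = (List.finRange n).flatMap fun i => termVars (ts i) := by
  rw [termVars, List.ofFn_eq_map]
  rfl

theorem termVars_subst (t : L.Term V) (σ : V → L.Term V) :
    termVars (t.subst σ) = (termVars t).flatMap fun x => termVars (σ x) := by
  induction t with
  | var x => simp [FirstOrder.Language.Term.subst]
  | func f ts ih =>
    simp only [FirstOrder.Language.Term.subst, termVars_func_eq, ih, List.flatMap_assoc]

theorem subst_subst (t : L.Term V) (σ τ : V → L.Term V) :
    (t.subst σ).subst τ = t.subst fun x => (σ x).subst τ := by
  induction t with
  | var x => rfl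
  | func f ts ih =>
    simp only [FirstOrder.Language.Term.subst]
    congr 1
    funext i
    exact ih i

theorem subst_congr {t : L.Term V} {σ τ : V → L.Term V} (h : ∀ x ∈ termVars t, σ x = τ x) :
    t.subst σ = t.subst τ := by
  induction t with
  | var x => exact h x (by simp)
  | func f ts ih =>
    simp only [FirstOrder.Language.Term.subst]
    congr 1
    funext i
    exact ih i fun x hx => h x (mem_termVars_func.2 ⟨i, hx⟩)

theorem subst_var (t : L.Term V) : t.subst .var = t := by
  induction t with
  | var x => rfl
  | func f ts ih =>
    simp only [FirstOrder.Language.Term.subst]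
    congr 1
    funext i
    exact ih i

/-- Used to see that an mgu acts as a renaming on the variables of another mgu's values. -/
theorem eq_var_of_subst_eq_self {t : L.Term V} {σ : V → L.Term V} (h : t.subst σ = t) :
    ∀ x ∈ termVars t, σ x = .var x := by
  induction t with
  | var y =>
    intro x hx
    obtain rfl : x = y := by simpa using hx
    exact h
  | func f ts ih =>
    intro x hx
    obtain ⟨i, hi⟩ := mem_termVars_func.1 hx
    simp only [FirstOrder.Language.Term.subst, FirstOrder.Language.Term.func.injEq, true_and,
      heq_eq_eq] at h
    exact ih i (congrFun h i) x hi

theorem single_self (x : V) (t : L.Term V) : single x t x = t := if_pos rfl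

theorem single_of_ne {x y : V} (t : L.Term V) (h : y ≠ x) : single x t y = .var y := if_neg h

theorem termVars_single (x : V) (t : L.Term V) :
    (fun y => termVars (single x t y)) = repl x (termVars t) := by
  funext y
  unfold single repl
  split_ifs
  exacts [rfl, termVars_var y]

theorem subst_single_of_notMem {x : V} {s t : L.Term V} (h : x ∉ termVars s) :
    s.subst (single x t) = s := by
  conv_rhs => rw [← subst_var s]
  exact subst_congr fun y hy => single_of_ne t fun e : y = x => h (e ▸ hy)

theorem mem_termVars_subst_single {x y : V} {s t : L.Term V} :
    y ∈ termVars (s.subst (single x t)) ↔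
      (y ∈ termVars s ∧ y ≠ x) ∨ (x ∈ termVars s ∧ y ∈ termVars t) := by
  rw [termVars_subst, termVars_single, mem_flatMap_repl]

theorem subst_single_subst {x : V} {s t : L.Term V} {η : V → L.Term V} (h : η x = t.subst η) :
    (s.subst (single x t)).subst η = s.subst η := by
  rw [subst_subst]
  congr 1
  funext y
  by_cases hy : y = x
  · rw [hy, single_self, h]
  · rw [single_of_ne t hy]
    rfl

/-- The number of symbols of a term, where each argument counts. -/
def termSize : L.Term V → ℕ
  | .var _ => 1
  | .func _ ts => 1 + ∑ i, termSize (ts i)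

/-! ### Equations between terms -/

/-- An equation between terms, as a pair. -/
abbrev Eqn (L : FirstOrder.Language.{u, v}) (V : Type w) := L.Term V × L.Term V

namespace Eqn

def toEquation (e : Eqn L V) : Equation L V := .term e.1 e.2

def Occurs (x : V) (e : Eqn L V) : Prop := x ∈ termVars e.1 ∨ x ∈ termVars e.2

def subst (σ : V → L.Term V) (e : Eqn L V) : Eqn L V := (e.1.subst σ, e.2.subst σ)

theorem toEquation_injective : Function.Injective (toEquation : Eqn L V → Equation L V) := by
  rintro ⟨a, b⟩ ⟨c, d⟩ h
  simpa [toEquation] using h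

theorem occurs_subst_single {x y : V} {t : L.Term V} {e : Eqn L V} :
    Occurs y (subst (single x t) e) ↔
      (Occurs y e ∧ y ≠ x) ∨ (Occurs x e ∧ y ∈ termVars t) := by
  simp only [Occurs, subst, mem_termVars_subst_single]
  tauto

theorem subst_single_of_not_occurs {x : V} {t : L.Term V} {e : Eqn L V} (h : ¬ Occurs x e) :
    subst (single x t) e = e :=
  Prod.ext (subst_single_of_notMem fun hx => h (.inl hx))
    (subst_single_of_notMem fun hx => h (.inr hx))

end Eqn

/-- `Solve E r`: the equations `E` can be solved by decomposition, swapping and elimination of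
variables; the result is a substitution, or `none` if a clash of symbols is met. -/
inductive Solve : Set (Eqn L V) → Option (V → L.Term V) → Prop
  | nil : Solve ∅ (some .var)
  | clash {E : Set (Eqn L V)} {n m : ℕ} (f : L.Functions n) (g : L.Functions m)
      (s : Fin n → L.Term V) (t : Fin m → L.Term V)
      (hne : (⟨n, f⟩ : Σ k, L.Functions k) ≠ ⟨m, g⟩) (h : (.func f s, .func g t) ∈ E) :
      Solve E none
  | decompose {E : Set (Eqn L V)} {r : Option (V → L.Term V)} {n : ℕ} (f : L.Functions n)
      (s t : Fin n → L.Term V) (h : (.func f s, .func f t) ∈ E)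
      (hr : Solve (E \ {(.func f s, .func f t)} ∪ Set.range fun i => (s i, t i)) r) : Solve E r
  | swap {E : Set (Eqn L V)} {r : Option (V → L.Term V)} (t : L.Term V) (x : V)
      (ht : ∀ y, t ≠ .var y) (h : (t, .var x) ∈ E)
      (hr : Solve (E \ {(t, .var x)} ∪ {(.var x, t)}) r) : Solve E r
  | eliminate {E : Set (Eqn L V)} {r : Option (V → L.Term V)} (x : V) (t : L.Term V)
      (hx : x ∉ termVars t) (h : (.var x, t) ∈ E)
      (hr : Solve (Eqn.subst (single x t) '' (E \ {(.var x, t)})) r) :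
      Solve E (r.map fun σ y => (single x t y).subst σ)

/-- `S` consists of solved equations with respect to the remaining equations `E`. -/
def Solved (S E : Set (Eqn L V)) : Prop :=
  ∀ e ∈ S, ∃ y u, e = (.var y, u) ∧ y ∉ termVars u ∧ (∀ e' ∈ S, e' ≠ e → ¬ Eqn.Occurs y e') ∧
    ∀ e' ∈ E, ¬ Eqn.Occurs y e'

theorem Solved.mono {S E E' : Set (Eqn L V)} (h : Solved S E)
    (hE : ∀ e' ∈ E', ∀ x, Eqn.Occurs x e' → ∃ e ∈ E, Eqn.Occurs x e) : Solved S E' := by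
  intro e he
  obtain ⟨y, u, h₁, h₂, h₃, h₄⟩ := h e he
  refine ⟨y, u, h₁, h₂, h₃, fun e' he' ho => ?_⟩
  obtain ⟨e'', he'', ho'⟩ := hE e' he' y ho
  exact h₄ e'' he'' ho'

/-- A solved equation cannot belong to `E`, as its left variable would occur there. Hence an action
on an equation of `E` removes nothing from `S`. -/
theorem Solved.image_sdiff {S E : Set (Eqn L V)} (h : Solved S E) {e : Eqn L V} (he : e ∈ E) :
    Eqn.toEquation '' (S ∪ E) \ {Eqn.toEquation e} = Eqn.toEquation '' (S ∪ E \ {e}) := by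
  have hS : e ∉ S := by
    intro heS
    obtain ⟨y, u, rfl, -, -, h₄⟩ := h e heS
    exact h₄ _ he (.inl (by simp))
  rw [← Set.image_singleton, ← Set.image_sdiff Eqn.toEquation_injective, Set.union_sdiff_distrib,
    Set.sdiff_singleton_eq_self hS]

theorem Solved.not_act {S : Set (Eqn L V)} (h : Solved S ∅) (a : Action)
    (r : Option (Set (Equation L V))) : ¬ Act a (Eqn.toEquation '' S) r := by
  have key : ∀ s t, Equation.term s t ∈ Eqn.toEquation '' S → ∃ y, s = .var y ∧
      y ∉ termVars t ∧ ∀ e' ∈ S, e' ≠ (s, t) → ¬ Eqn.Occurs y e' := by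
    rintro s t ⟨⟨s', t'⟩, he, heq⟩
    simp only [Eqn.toEquation, Equation.term.injEq] at heq
    obtain ⟨rfl, rfl⟩ := heq
    obtain ⟨y, u, h₁, h₂, h₃, -⟩ := h _ he
    obtain ⟨rfl, rfl⟩ := Prod.mk.inj h₁
    exact ⟨y, rfl, h₂, h₃⟩
  intro hact
  cases hact with
  | decompose f s t h => obtain ⟨y, hy, -⟩ := key _ _ h; cases hy
  | decomposeAtom p s t h => obtain ⟨e, -, he⟩ := h; cases he
  | clash f g s t hne h => obtain ⟨y, hy, -⟩ := key _ _ h; cases hy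
  | clashAtom A B hne h => obtain ⟨e, -, he⟩ := h; cases he
  | delete x h =>
    obtain ⟨y, hy, hy', -⟩ := key _ _ h
    cases hy
    simp at hy'
  | swap t x ht h => obtain ⟨y, hy, -⟩ := key _ _ h; exact ht y hy
  | eliminate x t hx h hother =>
    obtain ⟨y, hy, -, h₃⟩ := key _ _ h
    cases hy
    obtain ⟨_, ⟨⟨e, he, rfl⟩, hne⟩, ho⟩ := hother
    exact h₃ e he (fun h' => hne (by rw [h']; rfl)) ho
  | occurCheck x t hx hne h =>
    obtain ⟨y, hy, hy', -⟩ := key _ _ h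
    cases hy
    exact hy' hx

/-- Solving equations yields a run of the algorithm without occur-check. -/
theorem Solve.exists_run {E : Set (Eqn L V)} {r : Option (V → L.Term V)} (h : Solve E r) :
    ∀ S, Solved S E → WNSTO (Eqn.toEquation '' (S ∪ E)) := by
  induction h with
  | nil =>
    intro S hS
    rw [Set.union_empty]
    exact ⟨[], .done _ hS.not_act, by simp⟩
  | clash f g s t hne h =>
    intro S hS
    exact ⟨[.clash], .act (.clash f g s t hne ⟨_, .inr h, rfl⟩) .failed, by simp⟩
  | @decompose E r n f s t h hr ih =>
    intro S hS
    obtain ⟨as, hrun, has⟩ := ih S (hS.mono (by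
      rintro e' (he' | ⟨i, rfl⟩) x hx
      · exact ⟨e', he'.1, hx⟩
      · exact ⟨_, h, hx.imp (fun hx => mem_termVars_func.2 ⟨i, hx⟩)
          fun hx => mem_termVars_func.2 ⟨i, hx⟩⟩))
    refine ⟨.decompose :: as, .act (.decompose f s t ⟨_, .inr h, rfl⟩) ?_, by simpa using has⟩
    convert hrun using 2
    have := hS.image_sdiff h
    rw [Eqn.toEquation] at this
    rw [this, ← Set.union_assoc, Set.image_union _ _ (Set.range _), ← Set.range_comp]
    rfl
  | @swap E r t x ht h hr ih =>
    intro S hS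
    obtain ⟨as, hrun, has⟩ := ih S (hS.mono (by
      rintro e' (he' | rfl) y hy
      · exact ⟨e', he'.1, hy⟩
      · exact ⟨_, h, hy.symm⟩))
    refine ⟨.swap :: as, .act (.swap t x ht ⟨_, .inr h, rfl⟩) ?_, by simpa using has⟩
    convert hrun using 2
    have := hS.image_sdiff h
    rw [Eqn.toEquation] at this
    rw [this, ← Set.union_assoc, Set.image_union _ _ {(_, _)}, Set.image_singleton]
    rfl
  | @eliminate E r x t hx h hr ih =>
    intro S hS
    -- The equation `x ≐ t` becomes solved: `{x/t}` erases `x` everywhere else. Previously solved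
    -- variables stay solved because they do not occur in `x ≐ t`, which belonged to `E`.
    have hS' : Solved (Eqn.subst (single x t) '' S ∪ {(.var x, t)})
        (Eqn.subst (single x t) '' (E \ {(.var x, t)})) := by
      have hxs : ∀ e, ¬ Eqn.Occurs x (Eqn.subst (single x t) e) := fun e he => by
        rcases Eqn.occurs_subst_single.1 he with he | he
        exacts [he.2 rfl, hx he.2]
      rintro _ (⟨e, he, rfl⟩ | rfl)
      · obtain ⟨y, u, rfl, h₂, h₃, h₄⟩ := hS e he
        have hy := h₄ _ h
        simp only [Eqn.Occurs, termVars_var, List.mem_singleton, not_or] at hy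
        have hys : ∀ e, ¬ Eqn.Occurs y e → ¬ Eqn.Occurs y (Eqn.subst (single x t) e) := by
          intro e he he'
          rcases Eqn.occurs_subst_single.1 he' with he' | he'
          exacts [he he'.1, hy.2 he'.2]
        refine ⟨y, u.subst (single x t), ?_, ?_, ?_, ?_⟩
        · exact Prod.ext (single_of_ne t hy.1) rfl
        · rw [mem_termVars_subst_single]
          tauto
        · rintro _ (⟨e', he', rfl⟩ | rfl) hne
          · exact hys _ (h₃ e' he' fun e => hne (by rw [e]))
          · simpa [Eqn.Occurs] using hy
        · rintro _ ⟨e', he', rfl⟩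
          exact hys _ (h₄ e' he'.1)
      · refine ⟨x, t, rfl, hx, ?_, ?_⟩
        · rintro _ (⟨e', he', rfl⟩ | rfl) hne
          exacts [hxs _, absurd rfl hne]
        · rintro _ ⟨e', he', rfl⟩
          exact hxs _
    obtain ⟨as, hrun, has⟩ := ih _ hS'
    have hT : Eqn.toEquation '' (Eqn.subst (single x t) '' S ∪ {(.var x, t)} ∪
        Eqn.subst (single x t) '' (E \ {(.var x, t)})) =
        Equation.subst (single x t) '' (Eqn.toEquation '' (S ∪ E) \ {.term (.var x) t}) ∪
          {.term (.var x) t} := by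
      have := hS.image_sdiff h
      rw [Eqn.toEquation] at this
      rw [this, Set.union_right_comm, ← Set.image_union, Set.image_union _ _ {(_, _)},
        Set.image_singleton, Set.image_image, Set.image_image]
      rfl
    rw [hT] at hrun
    by_cases hother : ∃ e ∈ Eqn.toEquation '' (S ∪ E) \ {.term (.var x) t}, e.Occurs x
    · exact ⟨.eliminate :: as, .act (.eliminate x t hx ⟨_, .inr h, rfl⟩ hother) hrun,
        by simpa using has⟩
    -- The algorithm may not eliminate `x` when it occurs in no other equation, but then `{x/t}`
    -- changes nothing and no action is needed.
    · refine ⟨as, ?_, has⟩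
      convert hrun using 2
      have himg : Equation.subst (single x t) ''
          (Eqn.toEquation '' (S ∪ E) \ {.term (.var x) t}) =
          Eqn.toEquation '' (S ∪ E) \ {.term (.var x) t} := by
        refine (Set.image_congr ?_).trans (Set.image_id _)
        rintro _ ⟨⟨e, he, rfl⟩, hne⟩
        exact congrArg Eqn.toEquation (Eqn.subst_single_of_not_occurs (t := t) fun ho =>
          hother ⟨_, ⟨⟨e, he, rfl⟩, hne⟩, ho⟩)
      rw [himg, Set.sdiff_union_of_subset]
      exact Set.singleton_subset_iff.2 ⟨_, .inr h, rfl⟩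

/-- Solving unifiable equations yields a most general unifier. -/
theorem Solve.exists_mgu {E : Set (Eqn L V)} {r : Option (V → L.Term V)} (h : Solve E r)
    (η : V → L.Term V) (hη : ∀ e ∈ E, e.1.subst η = e.2.subst η) :
    ∃ σ, r = some σ ∧ (∀ e ∈ E, e.1.subst σ = e.2.subst σ) ∧ {x | σ x ≠ .var x}.Finite ∧
      ∀ η : V → L.Term V, (∀ e ∈ E, e.1.subst η = e.2.subst η) → ∀ x, η x = (σ x).subst η := by
  induction h generalizing η with
  | nil => exact ⟨.var, rfl, by simp, by simp, fun η _ x => rfl⟩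
  | clash f g s t hne h =>
    have := hη _ h
    simp only [FirstOrder.Language.Term.subst, FirstOrder.Language.Term.func.injEq] at this
    obtain ⟨rfl, h₁, -⟩ := this
    exact absurd (by rw [eq_of_heq h₁]) hne
  | @decompose E r n f s t h hr ih =>
    have key : ∀ η : V → L.Term V, (∀ e ∈ E, e.1.subst η = e.2.subst η) ↔
        ∀ e ∈ E \ {(.func f s, .func f t)} ∪ Set.range fun i => (s i, t i),
          e.1.subst η = e.2.subst η := by
      intro η
      have hft : (FirstOrder.Language.Term.func f s).subst η =
          (FirstOrder.Language.Term.func f t).subst η ↔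
          ∀ i, (s i).subst η = (t i).subst η := by
        simp only [FirstOrder.Language.Term.subst, FirstOrder.Language.Term.func.injEq, true_and,
          heq_eq_eq, funext_iff]
      constructor
      · rintro hη _ (he | ⟨i, rfl⟩)
        exacts [hη _ he.1, hft.1 (hη _ h) i]
      · intro hη e he
        by_cases hee : e = (.func f s, .func f t)
        · rw [hee]
          exact hft.2 fun i => hη _ (.inr ⟨i, rfl⟩)
        · exact hη e (.inl ⟨he, hee⟩)
    obtain ⟨σ, h₁, h₂, h₃, h₄⟩ := ih η ((key η).1 hη)
    exact ⟨σ, h₁, (key σ).2 h₂, h₃, fun η hη => h₄ η ((key η).1 hη)⟩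
  | @swap E r t x ht h hr ih =>
    have key : ∀ η : V → L.Term V, (∀ e ∈ E, e.1.subst η = e.2.subst η) ↔
        ∀ e ∈ E \ {(t, .var x)} ∪ {(.var x, t)}, e.1.subst η = e.2.subst η := by
      intro η
      constructor
      · rintro hη _ (he | rfl)
        exacts [hη _ he.1, (hη _ h).symm]
      · intro hη e he
        by_cases hee : e = (t, .var x)
        · rw [hee]
          exact (hη _ (.inr rfl)).symm
        · exact hη e (.inl ⟨he, hee⟩)
    obtain ⟨σ, h₁, h₂, h₃, h₄⟩ := ih η ((key η).1 hη)
    exact ⟨σ, h₁, (key σ).2 h₂, h₃, fun η hη => h₄ η ((key η).1 hη)⟩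
  | @eliminate E r x t hx h hr ih =>
    have key : ∀ η : V → L.Term V, (∀ e ∈ E, e.1.subst η = e.2.subst η) →
        ∀ e ∈ Eqn.subst (single x t) '' (E \ {(.var x, t)}), e.1.subst η = e.2.subst η := by
      rintro η hη _ ⟨e, he, rfl⟩
      simp only [Eqn.subst]
      rw [subst_single_subst (hη _ h), subst_single_subst (hη _ h)]
      exact hη _ he.1
    obtain ⟨σ, rfl, h₂, h₃, h₄⟩ := ih η (key η hη)
    refine ⟨_, rfl, ?_, ?_, ?_⟩
    · intro e he
      rw [← subst_subst, ← subst_subst]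
      by_cases hee : e = (.var x, t)
      · subst hee
        change (single x t x).subst σ = _
        rw [single_self, subst_single_of_notMem hx]
      · exact h₂ _ ⟨e, ⟨he, hee⟩, rfl⟩
    · refine (h₃.union (Set.finite_singleton x)).subset fun y hy => ?_
      by_cases hyx : y = x
      · exact .inr hyx
      · refine .inl fun hσ => hy ?_
        beta_reduce
        rw [single_of_ne t hyx]
        exact hσ
    -- A unifier absorbs `{x/t}`, because it solves `x ≐ t`, and absorbs `σ` by induction. This is
    -- stronger than being an instance of the mgu: the unifier is its own factor.
    · intro η' hη' y
      rw [subst_subst, ← subst_congr fun z _ => h₄ η' (key η' hη') z]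
      exact (subst_single_subst (s := .var y) (hη' _ h)).symm

/-- Swapping alone does not decrease the termination measure, so it is merged with the elimination
that follows. The swapped equation may already be in `E`, hence both orientations are removed. -/
theorem Solve.eliminate_right {E : Set (Eqn L V)} {r : Option (V → L.Term V)} (t : L.Term V)
    (x : V) (ht : ∀ y, t ≠ .var y) (hx : x ∉ termVars t) (h : (t, .var x) ∈ E)
    (hr : Solve (Eqn.subst (single x t) '' (E \ {(t, .var x), (.var x, t)})) r) :
    Solve E (r.map fun σ y => (single x t y).subst σ) := by
  refine .swap t x ht h (.eliminate x t hx (.inr rfl) ?_)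
  convert hr using 2
  ext e
  simp only [Set.mem_sdiff, Set.mem_union, Set.mem_insert_iff, Set.mem_singleton_iff]
  tauto

/-! ### Termination -/

def eqnVars (P : List (Eqn L V)) : Set V := {x | ∃ e ∈ P, Eqn.Occurs x e}

theorem eqnVars_finite (P : List (Eqn L V)) : (eqnVars P).Finite := by
  have : eqnVars P = ⋃ e ∈ {e | e ∈ P}, ({x | x ∈ termVars e.1} ∪ {x | x ∈ termVars e.2}) := by
    ext x
    simp [eqnVars, Eqn.Occurs]
  rw [this]
  exact (List.finite_toSet P).biUnion fun e _ => (List.finite_toSet _).union (List.finite_toSet _)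

/-- The total size of a list of equations. -/
def eqnSize (P : List (Eqn L V)) : ℕ := (P.map fun e => termSize e.1 + termSize e.2).sum

/-- The order for which solving equations terminates. -/
def Smaller (P' P : List (Eqn L V)) : Prop :=
  (eqnVars P').ncard < (eqnVars P).ncard ∨
    (eqnVars P').ncard ≤ (eqnVars P).ncard ∧ eqnSize P' < eqnSize P

theorem smaller_wf : WellFounded (Smaller : List (Eqn L V) → List (Eqn L V) → Prop) := by
  have h : WellFounded (InvImage (Prod.Lex (· < ·) (· < ·))
      fun P : List (Eqn L V) => ((eqnVars P).ncard, eqnSize P)) :=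
    InvImage.wf _ (WellFounded.prod_lex wellFounded_lt wellFounded_lt)
  refine Subrelation.wf (fun {P' P} hP => ?_) h
  rw [InvImage, Prod.lex_def]
  rcases hP with hP | ⟨h₁, h₂⟩
  · exact .inl hP
  · rcases h₁.lt_or_eq with h₁ | h₁
    exacts [.inl h₁, .inr ⟨h₁, h₂⟩]

/-- No variable is added and the two outer symbols disappear. The sublist `F` allows further copies
of the decomposed equation to be dropped. -/
theorem smaller_decompose {n : ℕ} (f : L.Functions n) (s t : Fin n → L.Term V)
    {F P : List (Eqn L V)} (h : F.Sublist P) :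
    Smaller ((List.finRange n).map (fun i => (s i, t i)) ++ F) ((.func f s, .func f t) :: P) := by
  refine .inr ⟨Set.ncard_le_ncard ?_ (eqnVars_finite _), ?_⟩
  · rintro x ⟨e, he, hx⟩
    rcases List.mem_append.1 he with he | he
    · obtain ⟨i, -, rfl⟩ := List.mem_map.1 he
      exact ⟨_, List.mem_cons_self, hx.imp (fun hx => mem_termVars_func.2 ⟨i, hx⟩)
        fun hx => mem_termVars_func.2 ⟨i, hx⟩⟩
    · exact ⟨e, List.mem_cons_of_mem _ (h.subset he), hx⟩
  · have h₁ : eqnSize F ≤ eqnSize P :=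
      (h.map _).sum_le_sum fun _ _ => Nat.zero_le _
    have h₂ : ((List.finRange n).map fun i => termSize (s i) + termSize (t i)).sum =
        ∑ i, termSize (s i) + ∑ i, termSize (t i) := by
      rw [← Fin.sum_univ_def, Finset.sum_add_distrib]
    simp only [eqnSize, List.map_append, List.map_map, List.sum_append, List.map_cons,
      List.sum_cons, termSize, Function.comp_def] at h₁ ⊢
    omega

/-- Terms may grow, but the variable `x` is gone for good. -/
theorem smaller_eliminate {P' P : List (Eqn L V)} {x : V} {t : L.Term V} (hx : x ∉ termVars t)
    (hxP : x ∈ eqnVars P) (ht : ∀ y ∈ termVars t, y ∈ eqnVars P)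
    (h : ∀ e' ∈ P', ∃ e ∈ P, e' = Eqn.subst (single x t) e) : Smaller P' P := by
  refine .inl (Set.ncard_lt_ncard ⟨?_, fun hsub => ?_⟩ (eqnVars_finite _))
  · rintro y ⟨e', he', hy⟩
    obtain ⟨e, he, rfl⟩ := h e' he'
    rcases Eqn.occurs_subst_single.1 hy with hy | hy
    exacts [⟨e, he, hy.1⟩, ht y hy.2]
  · obtain ⟨e', he', hy⟩ := hsub hxP
    obtain ⟨e, he, rfl⟩ := h e' he'
    rcases Eqn.occurs_subst_single.1 hy with hy | hy
    exacts [hy.2 rfl, hx hy.2]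

/-! ### Solving tidy equations -/

/-- The item of an equation, where the flag tells whether its left side is the input. -/
def Eqn.item (p : Bool × Eqn L V) : Item V :=
  if p.1 then (termVars p.2.1, termVars p.2.2) else (termVars p.2.2, termVars p.2.1)

theorem Eqn.item_subst (b : Bool) (e : Eqn L V) (σ : V → L.Term V) :
    Eqn.item (b, Eqn.subst σ e) = Item.bind (fun x => termVars (σ x)) (Eqn.item (b, e)) := by
  cases b <;> simp [Eqn.item, Eqn.subst, Item.bind, termVars_subst]

theorem Item.bind_termVars_subst (σ τ : V → L.Term V) (a : Item V) :
    Item.bind (fun x => termVars (τ x)) (Item.bind (fun x => termVars (σ x)) a) =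
      Item.bind (fun x => termVars ((σ x).subst τ)) a := by
  rw [Item.bind_bind]
  simp only [termVars_subst]

open Classical in
/-- Tidy equations can be solved, and this preserves the tidiness of further items. -/
theorem exists_solve_of_tidyItems (E : List (Bool × Eqn L V)) (X : List (Item V))
    (h : TidyItems (E.map Eqn.item ++ X)) :
    ∃ r, Solve {e | ∃ b, (b, e) ∈ E} r ∧
      ∀ σ, r = some σ → TidyItems (X.map (Item.bind fun x => termVars (σ x))) := by
  induction E using (InvImage.wf (List.map Prod.snd) smaller_wf).induction generalizing X with
  | _ E ih =>
  rcases E with _ | ⟨⟨b, l, r⟩, E⟩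
  · refine ⟨some .var, by simpa using Solve.nil, ?_⟩
    rintro σ hσ
    cases hσ
    have : X.map (Item.bind fun x => termVars (.var x : L.Term V)) = X :=
      (List.map_congr_left fun a _ =>
        Item.bind_eq_self fun x _ => termVars_var x).trans (List.map_id _)
    rw [this]
    simpa using h
  -- Covers a variable on either side and either flag. Tidiness supplies `x ∉ termVars t`, which is
  -- what makes the occur-check superfluous.
  have elim : ∀ x t (F : List (Bool × Eqn L V)), F.Sublist E →
      (l, r) = (.var x, t) ∨ (l, r) = (t, .var x) → x ∉ termVars t ∧
      ∃ ρ, Solve (Eqn.subst (single x t) '' {e | ∃ b, (b, e) ∈ F}) (ρ : Option (V → L.Term V)) ∧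
        ∀ σ, ρ.map (fun σ y => (single x t y).subst σ) = some σ →
          TidyItems (X.map (Item.bind fun x => termVars (σ x))) := by
    intro x t F hF hlr
    have h₁ : TidyItems (Eqn.item (b, l, r) :: (F.map Eqn.item ++ X)) :=
      h.sublist (((hF.map _).append_right X).cons_cons _)
    have h₂ : Eqn.item (b, l, r) = ([x], termVars t) ∨ Eqn.item (b, l, r) = (termVars t, [x]) := by
      rcases hlr with e | e <;> rw [e] <;> cases b <;> simp [Eqn.item]
    obtain ⟨hx, h₃⟩ := TidyItems.eliminate (h₂.imp (fun e => e ▸ h₁) fun e => e ▸ h₁)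
    have h₄ : (F.map fun p => (p.1, Eqn.subst (single x t) p.2)).map Eqn.item =
        (F.map Eqn.item).map (Item.bind (repl x (termVars t))) := by
      simp only [List.map_map, Function.comp_def, Eqn.item_subst, termVars_single]
    rw [List.map_append, ← h₄] at h₃
    obtain ⟨ρ, hρ, hσ⟩ := ih (F.map fun p => (p.1, Eqn.subst (single x t) p.2)) (by
      have hocc : ∀ y, y = x ∨ y ∈ termVars t → Eqn.Occurs y (l, r) := by
        rcases hlr with e | e <;> rw [e] <;> simp [Eqn.Occurs, or_comm]
      refine smaller_eliminate hx ⟨(l, r), by simp, hocc x (.inl rfl)⟩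
        (fun y hy => ⟨(l, r), by simp, hocc y (.inr hy)⟩) ?_
      simp only [List.map_map, List.mem_map, Function.comp_def]
      rintro _ ⟨p, hp, rfl⟩
      exact ⟨p.2, ⟨p, List.mem_cons_of_mem _ (hF.subset hp), rfl⟩, rfl⟩) _ h₃
    refine ⟨hx, ρ, ?_, ?_⟩
    · convert hρ using 2
      ext e
      simp only [Set.mem_image, Set.mem_ofPred_eq, List.mem_map]
      constructor
      · rintro ⟨e, ⟨b, he⟩, rfl⟩
        exact ⟨b, (b, e), he, rfl⟩
      · rintro ⟨b, ⟨b', e⟩, he, heq⟩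
        exact ⟨e, ⟨b', he⟩, (Prod.mk.inj heq).2⟩
    · intro σ hσ'
      obtain ⟨τ, rfl, rfl⟩ := Option.map_eq_some_iff.1 hσ'
      have := hσ τ rfl
      rw [← termVars_single, List.map_map] at this
      simpa only [Function.comp_def, Item.bind_termVars_subst] using this
  have hmem : (l, r) ∈ {e | ∃ b', (b', e) ∈ (b, l, r) :: E} := ⟨b, List.mem_cons_self⟩
  cases l with
  | var x =>
    -- The list may repeat an equation, possibly with another flag, whereas an action on the set
    -- removes it once and for all; all copies are filtered out.
    obtain ⟨hx, ρ, hρ, hσ⟩ := elim x r (E.filter fun p => p.2 ≠ (.var x, r))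
      List.filter_sublist (.inl rfl)
    refine ⟨_, .eliminate x r hx hmem ?_, hσ⟩
    convert hρ using 3
    ext e
    simp only [List.mem_cons, List.mem_filter, Set.mem_sdiff, Set.mem_ofPred_eq, Prod.mk.injEq,
      Set.mem_singleton_iff, decide_eq_true_eq]
    grind
  | @func n f s =>
    cases r with
    | var x =>
      obtain ⟨hx, ρ, hρ, hσ⟩ := elim x (.func f s)
        (E.filter fun p => p.2 ≠ (.func f s, .var x) ∧ p.2 ≠ (.var x, .func f s))
        List.filter_sublist (.inr rfl)
      refine ⟨_, .eliminate_right _ x (by simp) hx hmem ?_, hσ⟩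
      convert hρ using 3
      ext e
      simp only [List.mem_cons, List.mem_filter, Set.mem_sdiff, Set.mem_ofPred_eq, Prod.mk.injEq,
        Set.mem_singleton_iff, Set.mem_insert_iff, decide_eq_true_eq]
      grind
    | @func m g t =>
      by_cases hne : (⟨n, f⟩ : Σ k, L.Functions k) = ⟨m, g⟩
      · cases hne
        have hF : (E.filter fun p => p.2 ≠ (.func f s, .func f t)).Sublist E :=
          List.filter_sublist
        obtain ⟨ρ, hρ, hσ⟩ := ih ((List.finRange n).map (fun i => (b, s i, t i)) ++
          E.filter fun p => p.2 ≠ (.func f s, .func f t)) (by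
            simpa [InvImage, Function.comp_def] using
              smaller_decompose f s t (hF.map Prod.snd)) X (by
            have := h.sublist (((hF.map _).append_right X).cons_cons _)
            rw [List.map_append, List.append_assoc, List.map_map]
            cases b <;> simp only [Eqn.item, termVars_func_eq] at this <;>
              exact this.decompose)
        refine ⟨ρ, .decompose f s t hmem ?_, hσ⟩
        convert hρ using 2
        ext e
        simp only [List.mem_cons, List.mem_append, List.mem_filter, Set.mem_sdiff,
          Set.mem_ofPred_eq, Prod.mk.injEq, Set.mem_singleton_iff, Set.mem_union, Set.mem_range,
          List.mem_map, List.mem_finRange, true_and, decide_eq_true_eq]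
        grind
      · exact ⟨none, .clash f g s t hne hmem, by simp⟩

/-! ### Solving equations with ground left sides first -/

open Classical in
/-- The map that removes the variables in `G`. -/
noncomputable def kill (G : Set V) (x : V) : List V := if x ∈ G then [] else [x]

/-- The variables on the right sides. -/
def rightVars (P : List (Eqn L V)) : Set V := {x | ∃ e ∈ P, x ∈ termVars e.2}

theorem subst_of_isGround {s : L.Term V} (h : IsGround s) (σ : V → L.Term V) : s.subst σ = s := by
  rw [IsGround] at h
  conv_rhs => rw [← subst_var s]
  exact subst_congr (by simp [h])

open Classical in
/-- Equations with ground left sides can be solved together with equations that become tidy when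
the variables of the former are removed. -/
theorem exists_solve_of_isGround (P : List (Eqn L V)) (E : List (Bool × Eqn L V))
    (X : List (Item V)) (hP : ∀ e ∈ P, IsGround e.1)
    (h : TidyItems ((E.map Eqn.item ++ X).map (Item.bind (kill (rightVars P))))) :
    ∃ r, Solve {e | e ∈ P ∨ ∃ b, (b, e) ∈ E} r ∧
      ∀ σ, r = some σ → TidyItems (X.map (Item.bind fun x => termVars (σ x))) := by
  induction P using smaller_wf.induction generalizing E X with
  | _ P ih =>
  rcases P with _ | ⟨⟨l, r⟩, P⟩
  · have : (E.map Eqn.item ++ X).map (Item.bind (kill (rightVars ([] : List (Eqn L V))))) =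
        E.map Eqn.item ++ X :=
      (List.map_congr_left fun a _ =>
        Item.bind_eq_self fun x _ => by simp [kill, rightVars]).trans (List.map_id _)
    rw [this] at h
    simpa using exists_solve_of_tidyItems E X h
  have hmem : (l, r) ∈ {e | e ∈ (l, r) :: P ∨ ∃ b, (b, e) ∈ E} := .inl List.mem_cons_self
  have hl : IsGround l := hP (l, r) List.mem_cons_self
  cases l with
  | var x => simp [IsGround] at hl
  | @func n f s =>
    cases r with
    | var x =>
      set l : L.Term V := .func f s with hldef
      have hvl : termVars l = [] := hl
      have hx : x ∉ termVars l := by simp [hvl]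
      let P' := (P.filter fun e => e ≠ (l, .var x)).map (Eqn.subst (single x l))
      let E' := (E.filter fun p => p.2 ≠ (l, .var x) ∧ p.2 ≠ (.var x, l)).map
        fun p => (p.1, Eqn.subst (single x l) p.2)
      -- Binding `x` to a ground term deletes its occurrences, so this followed by deleting the
      -- variables still to be bound is the same as deleting all of them at once. The tidiness
      -- hypothesis thus passes to the smaller system.
      have hkill : ∀ y, (termVars (single x l y)).flatMap (kill (rightVars P')) =
          kill (rightVars ((l, .var x) :: P)) y := by
        intro y
        by_cases hy : y = x
        · subst hy
          rw [single_self, hvl]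
          simp [kill, rightVars]
        · rw [single_of_ne l hy, termVars_var, List.flatMap_singleton, kill, kill]
          congr 1
          simp only [rightVars, P', Set.mem_ofPred_eq, eq_iff_iff]
          constructor
          · rintro ⟨_, he', hye⟩
            obtain ⟨e, he, rfl⟩ := List.mem_map.1 he'
            simp only [Eqn.subst, mem_termVars_subst_single, hvl] at hye
            exact ⟨e, List.mem_cons_of_mem _ (List.mem_of_mem_filter he), by simp_all⟩
          · rintro ⟨e, he, hye⟩
            have hne : e ≠ (l, .var x) := by
              rintro rfl
              simp [hy] at hye
            refine ⟨_, List.mem_map_of_mem (List.mem_filter.2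
              ⟨(List.mem_cons.1 he).resolve_left hne, by simpa using hne⟩), ?_⟩
            exact mem_termVars_subst_single.2 (.inl ⟨hye, hy⟩)
      obtain ⟨ρ, hρ, hσ⟩ := ih P' (by
        refine smaller_eliminate hx ⟨(l, .var x), by simp, .inr (by simp)⟩ (by simp [hvl]) ?_
        intro e' he'
        obtain ⟨e, he, rfl⟩ := List.mem_map.1 he'
        exact ⟨e, List.mem_cons_of_mem _ (List.mem_of_mem_filter he), rfl⟩) E'
        (X.map (Item.bind fun y => termVars (single x l y))) (by
          intro e' he'
          obtain ⟨e, he, rfl⟩ := List.mem_map.1 he'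
          have := hP e (List.mem_cons_of_mem _ (List.mem_of_mem_filter he))
          simpa only [Eqn.subst, subst_of_isGround this] using this) (by
          have hs := h.sublist (((((List.filter_sublist (l := E) (p := fun p =>
            p.2 ≠ (l, .var x) ∧ p.2 ≠ (.var x, l))).map Eqn.item).append_right X)).map _)
          simpa only [E', List.map_append, List.map_map, Function.comp_def, Eqn.item_subst,
            Item.bind_bind, hkill] using hs)
      refine ⟨_, .eliminate_right l x (by simp [hldef]) hx hmem (r := ρ) ?_, ?_⟩
      · convert hρ using 2
        ext e
        -- Left sides in `P` are ground, so the reversed orientation, also removed by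
        -- `Solve.eliminate_right`, can only come from `E`.
        have h₁ : ∀ e ∈ P, e ≠ (.var x, l) := by
          rintro e he rfl
          have := hP _ (List.mem_cons_of_mem _ he)
          simp [IsGround] at this
        simp only [P', E', List.mem_map, List.mem_filter, Set.mem_image, Set.mem_sdiff,
          Set.mem_ofPred_eq, List.mem_cons, Set.mem_insert_iff, Set.mem_singleton_iff,
          decide_eq_true_eq]
        constructor
        · rintro ⟨e, ⟨(he | he) | ⟨b, he⟩, hne⟩, rfl⟩
          · exact absurd (.inl he) hne
          · exact .inl ⟨e, ⟨he, fun h => hne (.inl h)⟩, rfl⟩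
          · exact .inr ⟨b, (b, e), ⟨he, not_or.1 hne⟩, rfl⟩
        · rintro (⟨e, ⟨he, hne⟩, rfl⟩ | ⟨b, ⟨b', e⟩, ⟨he, hne⟩, heq⟩)
          · exact ⟨e, ⟨.inl (.inr he), not_or.2 ⟨hne, h₁ e he⟩⟩, rfl⟩
          · exact ⟨e, ⟨.inr ⟨b', he⟩, not_or.2 hne⟩, (Prod.mk.inj heq).2⟩
      · intro σ hσ'
        obtain ⟨τ, rfl, rfl⟩ := Option.map_eq_some_iff.1 hσ'
        have := hσ τ rfl
        rw [List.map_map] at this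
        simpa only [Function.comp_def, Item.bind_termVars_subst] using this
    | @func m g t =>
      by_cases hne : (⟨n, f⟩ : Σ k, L.Functions k) = ⟨m, g⟩
      · cases hne
        have hF : (P.filter fun e => e ≠ (.func f s, .func f t)).Sublist P := List.filter_sublist
        have hG : rightVars ((List.finRange n).map (fun i => (s i, t i)) ++
            P.filter fun e => e ≠ (.func f s, .func f t)) =
            rightVars ((.func f s, .func f t) :: P) := by
          ext y
          simp only [rightVars, Set.mem_ofPred_eq, List.mem_append, List.mem_map,
            List.mem_finRange, true_and, List.mem_filter, List.mem_cons, decide_eq_true_eq]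
          constructor
          · rintro ⟨e, ⟨i, rfl⟩ | he, hy⟩
            · exact ⟨_, .inl rfl, mem_termVars_func.2 ⟨i, hy⟩⟩
            · exact ⟨e, .inr he.1, hy⟩
          · rintro ⟨e, he, hy⟩
            by_cases hee : e = (.func f s, .func f t)
            · subst hee
              obtain ⟨i, hi⟩ := mem_termVars_func.1 hy
              exact ⟨_, .inl ⟨i, rfl⟩, hi⟩
            · exact ⟨e, .inr ⟨he.resolve_left hee, hee⟩, hy⟩
        obtain ⟨ρ, hρ, hσ⟩ := ih ((List.finRange n).map (fun i => (s i, t i)) ++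
          P.filter fun e => e ≠ (.func f s, .func f t)) (smaller_decompose f s t hF)
          (E.filter fun p => p.2 ≠ (.func f s, .func f t)) X (by
            intro e he
            rcases List.mem_append.1 he with he | he
            · obtain ⟨i, -, rfl⟩ := List.mem_map.1 he
              refine List.eq_nil_iff_forall_not_mem.2 fun y hy => ?_
              have := mem_termVars_func (f := f) |>.2 ⟨i, hy⟩
              rw [hl] at this
              simp at this
            · exact hP e (List.mem_cons_of_mem _ (hF.subset he))) (by
            rw [hG]
            exact h.sublist ((((List.filter_sublist).map Eqn.item).append_right X).map _))
        refine ⟨ρ, .decompose f s t hmem ?_, hσ⟩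
        convert hρ using 2
        ext e
        simp only [List.mem_cons, List.mem_append, List.mem_filter, Set.mem_sdiff,
          Set.mem_ofPred_eq, Set.mem_singleton_iff, Set.mem_union, Set.mem_range,
          List.mem_map, List.mem_finRange, true_and, decide_eq_true_eq]
        grind
      · exact ⟨none, .clash f g s t hne hmem, by simp⟩

/-! ### Items of clauses -/

theorem Atom.varsAt_subst (A : Atom L V) (σ : V → L.Term V) (s : Fin A.arity → Prop) :
    (A.subst σ).varsAt s = (A.varsAt s).flatMap fun x => termVars (σ x) := by
  simp only [Atom.varsAt, Atom.subst, termVars_subst, List.flatMap_assoc]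

theorem Atom.inVars_subst (M : Moding L) (A : Atom L V) (σ : V → L.Term V) :
    (A.subst σ).inVars M = (A.inVars M).flatMap fun x => termVars (σ x) :=
  A.varsAt_subst σ _

theorem Atom.item_subst (M : Moding L) (A : Atom L V) (σ : V → L.Term V) :
    (A.subst σ).item M = Item.bind (fun x => termVars (σ x)) (A.item M) :=
  Prod.ext (A.varsAt_subst σ _) (A.varsAt_subst σ _)

theorem Query.map_item_subst (M : Moding L) (Q : Query L V) (σ : V → L.Term V) :
    (Query.subst Q σ).map (Atom.item M) =
      (Q.map (Atom.item M)).map (Item.bind fun x => termVars (σ x)) := by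
  simp only [Query.subst, List.map_map, Function.comp_def, Atom.item_subst]

theorem Atom.mem_vars_of_mem_varsAt {A : Atom L V} {s : Fin A.arity → Prop} {x : V}
    (h : x ∈ A.varsAt s) : x ∈ A.vars := by
  obtain ⟨i, -, hi⟩ := List.mem_flatMap.1 h
  exact ⟨i, hi⟩

theorem Atom.mem_vars_of_mem_item {M : Moding L} {A : Atom L V} {x : V}
    (h : x ∈ (A.item M).1 ∨ x ∈ (A.item M).2) : x ∈ A.vars :=
  h.elim Atom.mem_vars_of_mem_varsAt Atom.mem_vars_of_mem_varsAt

/-- From inside the clause the head acts as a producer of its input variables. It can be listed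
first, with no inputs, since the body does not output these variables. -/
theorem Clause.Tidy.exists_nicelyModed {M : Moding L} {C : Clause L V} (h : C.Tidy M) :
    ∃ D : List (Item V), D.Perm (C.body.map (Atom.item M)) ∧
      NicelyModed (([], C.head.inVars M) :: D) := by
  obtain ⟨Q, hp, hn⟩ := h.1.exists_nicelyModed
  refine ⟨_, hp.map _, nicelyModed_split (D₁ := []) |>.2
    ⟨by simp [NicelyModed], hn, h.2.1, by simp, by simp, ?_, by simp⟩⟩
  simp only [List.mem_map]
  rintro _ ⟨A, hA, rfl⟩
  exact ⟨fun x hx => h.2.2 x hx A (hp.subset hA), by simp⟩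

theorem mem_of_mem_flatMap_kill {G : Set V} {l : List V} {x : V} (h : x ∈ l.flatMap (kill G)) :
    x ∈ l := by
  obtain ⟨y, hy, hx⟩ := List.mem_flatMap.1 h
  unfold kill at hx
  split_ifs at hx
  · simp at hx
  · rwa [List.mem_singleton.1 hx]

/-- When the variables in the `+` positions of its head are removed, a variant of a clause of a
weakly tidy program is tidy. -/
theorem WeaklyTidy.exists_nicelyModed {M : Moding3 L} {M' : Moding L} {P : Set (Clause L V)}
    (hP : WeaklyTidy M M' P) {C c : Clause L V} (hC : C ∈ P) (hc : c.IsVariant C) :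
    ∃ D : List (Item V),
      D.Perm ((c.body.map (Atom.item M')).map (Item.bind (kill (c.head.plusVars M)))) ∧
      NicelyModed (([], (c.head.inVars M').flatMap (kill (c.head.plusVars M))) :: D) := by
  obtain ⟨γ, ⟨hdom, hground⟩, ht⟩ := hP C hC
  obtain ⟨π, rfl⟩ := hc
  obtain ⟨D, hp, hn⟩ := ht.exists_nicelyModed
  -- Only the variables of the terms matter, so the choice of ground terms is irrelevant.
  have hγ : (fun x => termVars (γ.toFun x)) = kill (C.head.plusVars M) := by
    funext x
    by_cases hx : x ∈ C.head.plusVars M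
    · rw [kill, if_pos hx]
      exact hground x hx
    · have : γ.toFun x = .var x := by
        by_contra h
        exact hx (hdom ▸ h)
      simp [kill, hx, this]
  have hplus : ∀ x, π x ∈ (C.head.subst fun x => .var (π x)).plusVars M ↔
      x ∈ C.head.plusVars M := by
    intro x
    simp [Atom.plusVars, Atom.subst, termVars_subst]
  have hkill : ∀ x, kill ((C.head.subst fun x => .var (π x)).plusVars M) (π x) =
      (kill (C.head.plusVars M) x).flatMap fun y => [π y] := by
    intro x
    by_cases hx : x ∈ C.head.plusVars M
    · rw [kill, if_pos ((hplus x).2 hx), kill, if_pos hx]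
      rfl
    · rw [kill, if_neg (mt (hplus x).1 hx), kill, if_neg hx]
      rfl
  refine ⟨D.map (Item.bind fun y => [π y]), ?_, ?_⟩
  · refine (hp.map _).trans (List.Perm.of_eq ?_)
    simp only [Clause.subst, Query.map_item_subst, hγ, List.map_map, Function.comp_def,
      Item.bind_bind, termVars_var, List.flatMap_singleton, hkill]
  · have := hn.map_bind (f := fun y => [π y]) (by simp) (by
      intro _ _ _ _ x y _ _ hxy
      simpa using fun h => hxy h.symm)
    rw [List.map_cons] at this
    convert this using 2
    simp only [Item.bind, Clause.subst, Atom.inVars_subst, List.flatMap_nil, List.flatMap_assoc,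
      termVars_var, List.flatMap_singleton, hkill, ← hγ]

/-! ### Resolution -/

open Classical in
-- Abstract resolution gives one item for all input positions and one for all output positions.
-- Decomposed, they become the oriented equations, position by position. Those of the `+` positions
-- are dropped here because they are solved beforehand.
theorem tidyItems_resolve {M : Moding3 L} {M' : Moding L} {P : Set (Clause L V)}
    (hP : WeaklyTidy M M' P) {n : ℕ} {p : L.Relations n} {s t : Fin n → L.Term V}
    {q₁ q₂ B : Query L V} {C : Clause L V} (hC : C ∈ P)
    (hc : Clause.IsVariant ⟨⟨n, p, t⟩, B⟩ C) (hq : Query.Tidy M' (q₁ ++ ⟨n, p, s⟩ :: q₂))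
    (hd : Disjoint (Clause.vars ⟨⟨n, p, t⟩, B⟩) (Query.vars (q₁ ++ ⟨n, p, s⟩ :: q₂))) :
    TidyItems ((((((List.finRange n).filter fun i => M p i ≠ .input).map fun i =>
      (decide (M' p i = .input), s i, t i)).map Eqn.item) ++
        (q₁ ++ B ++ q₂).map (Atom.item M')).map
          (Item.bind (kill (Atom.plusVars M ⟨n, p, t⟩)))) := by
  set A : Atom L V := ⟨n, p, s⟩ with hA
  set H : Atom L V := ⟨n, p, t⟩ with hH
  set c : Clause L V := ⟨H, B⟩ with hcdef
  set K := kill (H.plusVars M) with hK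
  have hplus : ∀ x ∈ H.plusVars M, x ∈ c.vars := by
    rintro x ⟨i, -, hx⟩
    exact .inl ⟨i, hx⟩
  have hKA : ∀ A' ∈ q₁ ++ A :: q₂, ∀ x ∈ A'.vars, x ∉ c.vars ∧ K x = [x] := by
    intro A' hA' x hx
    have : x ∉ c.vars := fun hxc => Set.disjoint_left.1 hd hxc ⟨A', hA', hx⟩
    exact ⟨this, if_neg fun h => this (hplus x h)⟩
  obtain ⟨D, hDp, hDn⟩ := hP.exists_nicelyModed hC hc
  have hq' := query_tidy_iff.1 hq
  rw [List.map_append, List.map_cons] at hq'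
  obtain ⟨D₁, D₂, hp, hn⟩ := (hq'.perm List.perm_middle).exists_split
  have hD₁₂ : ∀ a ∈ D₁ ++ D₂, ∃ A' ∈ q₁ ++ A :: q₂, A'.item M' = a := by
    intro a ha
    rw [← List.map_append] at hp
    obtain ⟨A', hA', rfl⟩ := List.mem_map.1 (hp.subset ha)
    refine ⟨A', ?_, rfl⟩
    simp only [List.mem_append, List.mem_cons] at hA' ⊢
    tauto
  -- Standardizing apart lets `p` separate the variables of the query from those of the clause.
  have hres := NicelyModed.resolve (p := fun x => x ∉ c.vars)
    (ho := (H.outVars M').flatMap K) hn hDn (by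
      intro a ha x hx
      have : a ∈ D₁ ++ D₂ ∨ a = A.item M' := by
        simp only [List.mem_append, List.mem_cons] at ha ⊢
        tauto
      rcases this with ha | rfl
      · obtain ⟨A', hA', rfl⟩ := hD₁₂ a ha
        exact (hKA A' hA' x (Atom.mem_vars_of_mem_item hx)).1
      · exact (hKA A (by simp) x (Atom.mem_vars_of_mem_item hx)).1) (by
      intro a ha x hx
      rw [not_not]
      rcases List.mem_cons.1 ha with rfl | ha
      · have hx : x ∈ (H.inVars M').flatMap K := by simpa using hx
        exact .inl (Atom.mem_vars_of_mem_varsAt (mem_of_mem_flatMap_kill hx))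
      · obtain ⟨b, hb, rfl⟩ := List.mem_map.1 (hDp.subset ha)
        obtain ⟨B', hB', rfl⟩ := List.mem_map.1 hb
        exact .inr ⟨B', hB', Atom.mem_vars_of_mem_item
          (hx.imp mem_of_mem_flatMap_kill mem_of_mem_flatMap_kill)⟩) (by
      intro x hx
      rw [not_not]
      exact .inl (Atom.mem_vars_of_mem_varsAt (mem_of_mem_flatMap_kill hx)))
  simp only [Atom.inVars, Atom.outVars, Atom.varsAt, List.flatMap_assoc] at hres
  have hres₁ := hres.decompose
  rw [← List.append_assoc, ← List.append_assoc] at hres₁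
  have hres₂ := hres₁.decompose
  set I := (List.finRange n).filter fun i => M' p i = .input with hI
  set O := (List.finRange n).filter fun i => M' p i = .output with hO
  let g : Fin n → Item V := fun i => if M' p i = .input
    then (termVars (s i), (termVars (t i)).flatMap K)
    else ((termVars (t i)).flatMap K, termVars (s i))
  have hgI : I.map (fun i => (termVars (s i), (termVars (t i)).flatMap K)) = I.map g := by
    refine List.map_congr_left fun i hi => ?_
    have : M' p i = .input := by simpa [hI] using hi
    simp [g, this]
  have hgO : O.map (fun i => ((termVars (t i)).flatMap K, termVars (s i))) = O.map g := by
    refine List.map_congr_left fun i hi => ?_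
    have : M' p i = .output := by simpa [hO] using hi
    simp [g, this]
  have hio : (I ++ O).Perm (List.finRange n) := by
    have : O = (List.finRange n).filter fun i => !decide (M' p i = .input) := by
      refine List.filter_congr fun i _ => ?_
      cases h : M' p i <;> simp
    rw [this]
    exact List.filter_append_perm _ _
  -- Deleting the `+` variables of the head leaves the query side `s i` of each equation untouched.
  have hE : ((((List.finRange n).filter fun i => M p i ≠ .input).map fun i =>
      (decide (M' p i = .input), s i, t i)).map Eqn.item).map (Item.bind K) =
      ((List.finRange n).filter fun i => M p i ≠ .input).map g := by
    rw [List.map_map, List.map_map]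
    refine List.map_congr_left fun i _ => ?_
    have hs : (termVars (s i)).flatMap K = termVars (s i) :=
      flatMap_eq_self fun x hx => (hKA A (by simp) x ⟨i, hx⟩).2
    by_cases h : M' p i = .input <;> simp [g, h, Eqn.item, Item.bind, hs]
  have hX : ∀ q : Query L V, (∀ A' ∈ q, A' ∈ q₁ ++ A :: q₂) →
      (q.map (Atom.item M')).map (Item.bind K) = q.map (Atom.item M') := by
    intro q hq
    rw [List.map_map]
    refine List.map_congr_left fun A' hA' => ?_
    exact Item.bind_eq_self fun x hx => (hKA A' (hq A' hA') x (Atom.mem_vars_of_mem_item hx)).2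
  rw [hgI, hgO] at hres₂
  refine TidyItems.sublist (D := (List.finRange n).map g ++
    (q₁.map (Atom.item M') ++ (B.map (Atom.item M')).map (Item.bind K) ++ q₂.map (Atom.item M')))
    ⟨_, ?_, hres₂⟩ ?_
  · rw [← Multiset.coe_eq_coe] at hp hDp ⊢
    have hio' := Multiset.coe_eq_coe.2 (hio.map g)
    simp only [List.map_append, ← Multiset.coe_add] at hp hDp hio' ⊢
    rw [← hio', ← hDp, add_right_comm (q₁.map (Atom.item M') : Multiset (Item V)), ← hp]
    abel
  · rw [List.map_append, hE, List.map_append, List.map_append, List.map_append, List.map_append,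
      hX q₁ (by simp +contextual), hX q₂ (by simp +contextual)]
    exact (List.filter_sublist.map g).append_right _

open Classical in
theorem exists_solve_resolve {M : Moding3 L} {M' : Moding L} {P : Set (Clause L V)}
    (hP : WeaklyTidy M M' P) {n : ℕ} {p : L.Relations n} {s t : Fin n → L.Term V}
    {q₁ q₂ B : Query L V} {C : Clause L V} (hC : C ∈ P)
    (hc : Clause.IsVariant ⟨⟨n, p, t⟩, B⟩ C) (hq : Query.Tidy M' (q₁ ++ ⟨n, p, s⟩ :: q₂))
    (hd : Disjoint (Clause.vars ⟨⟨n, p, t⟩, B⟩) (Query.vars (q₁ ++ ⟨n, p, s⟩ :: q₂)))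
    (hg : ∀ i, M p i = .input → IsGround (s i)) :
    ∃ r, Solve (Set.range fun i => (s i, t i)) r ∧ ∀ σ, r = some σ →
      TidyItems (((q₁ ++ B ++ q₂).map (Atom.item M')).map
        (Item.bind fun x => termVars (σ x))) := by
  have h := tidyItems_resolve hP hC hc hq hd
  -- The equations at the `+` positions bind exactly the variables that weak tidiness allows to be
  -- deleted.
  have hG : rightVars (((List.finRange n).filter fun i => M p i = .input).map fun i =>
      (s i, t i)) = Atom.plusVars M ⟨n, p, t⟩ := by
    ext x
    simp [rightVars, Atom.plusVars]
  rw [← hG] at h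
  obtain ⟨r, hr, hσ⟩ := exists_solve_of_isGround _ _ _ (by
    intro e he
    obtain ⟨i, hi, rfl⟩ := List.mem_map.1 he
    exact hg i (by simpa using hi)) h
  refine ⟨r, ?_, hσ⟩
  convert hr using 2
  ext e
  simp only [Set.mem_range, List.mem_map, List.mem_filter, List.mem_finRange, true_and,
    Set.mem_ofPred_eq, Prod.mk.injEq, decide_eq_true_eq]
  constructor
  · rintro ⟨i, rfl⟩
    by_cases hi : M p i = .input
    · exact .inl ⟨i, hi, rfl⟩
    · exact .inr ⟨_, i, hi, rfl, rfl⟩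
  · rintro (⟨i, -, rfl⟩ | ⟨b, i, -, -, rfl⟩) <;> exact ⟨i, rfl⟩

theorem isUnifier_iff {n : ℕ} {p : L.Relations n} {s t : Fin n → L.Term V} {θ : Subst L V} :
    IsUnifier θ ⟨n, p, s⟩ ⟨n, p, t⟩ ↔
      ∀ e ∈ Set.range fun i => (s i, t i), e.1.subst θ.toFun = e.2.subst θ.toFun := by
  simp [IsUnifier, Atom.subst, funext_iff]

/-- A resolvent is tidy, whichever most general unifier is used. -/
theorem tidy_resolvent {M : Moding3 L} {M' : Moding L} {P : Set (Clause L V)}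
    (hP : WeaklyTidy M M' P) {n : ℕ} {p : L.Relations n} {s t : Fin n → L.Term V}
    {q₁ q₂ B : Query L V} {C : Clause L V} (hC : C ∈ P)
    (hc : Clause.IsVariant ⟨⟨n, p, t⟩, B⟩ C) (hq : Query.Tidy M' (q₁ ++ ⟨n, p, s⟩ :: q₂))
    (hd : Disjoint (Clause.vars ⟨⟨n, p, t⟩, B⟩) (Query.vars (q₁ ++ ⟨n, p, s⟩ :: q₂)))
    (hg : ∀ i, M p i = .input → IsGround (s i)) {θ : Subst L V}
    (hθ : IsMGU θ ⟨n, p, s⟩ ⟨n, p, t⟩) :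
    Query.Tidy M' (Query.subst (q₁ ++ B ++ q₂) θ.toFun) := by
  obtain ⟨r, hr, hX⟩ := exists_solve_resolve hP hC hc hq hd hg
  obtain ⟨σ, rfl, hσ, hfin, hmgu⟩ := hr.exists_mgu _ (isUnifier_iff.1 hθ.1)
  obtain ⟨δ, hδ⟩ := hθ.2 ⟨σ, hfin⟩ (isUnifier_iff.2 hσ)
  have hθσ := hmgu _ (isUnifier_iff.1 hθ.1)
  -- From `θ = σθ` and `σ = θδ` follows `σ = σθδ`, so `θδ` fixes the variables in the values of `σ`.
  -- There `θ` is a renaming with inverse `δ`; since `θ = σθ`, the resolvent under `θ` is a renaming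
  -- of the tidy resolvent under `σ`.
  have hren : ∀ x, ∀ y ∈ termVars (σ x), ∃ z, θ.toFun y = .var z ∧ δ.toFun z = .var y := by
    intro x y hy
    have h₁ : (σ x).subst (fun y => (θ.toFun y).subst δ.toFun) = σ x := by
      rw [← subst_subst, ← hθσ x, ← hδ x]
    have h₂ := eq_var_of_subst_eq_self h₁ y hy
    cases hz : θ.toFun y with
    | var z =>
      rw [hz] at h₂
      exact ⟨z, rfl, h₂⟩
    | func f ts =>
      rw [hz] at h₂
      cases h₂
  have hvars : ∀ a ∈ ((q₁ ++ B ++ q₂).map (Atom.item M')).map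
      (Item.bind fun x => termVars (σ x)), ∀ y, y ∈ a.1 ∨ y ∈ a.2 →
      ∃ z, θ.toFun y = .var z ∧ δ.toFun z = .var y := by
    intro a ha y hy
    obtain ⟨b, -, rfl⟩ := List.mem_map.1 ha
    rcases hy with hy | hy <;> obtain ⟨x, -, hy⟩ := List.mem_flatMap.1 hy <;> exact hren x y hy
  have h := (hX σ rfl).map_bind (f := fun x => termVars (θ.toFun x)) (by
    intro a ha y hy
    obtain ⟨z, hz, -⟩ := hvars a ha y hy
    simp [hz]) (by
    intro a ha b hb x y hx hy hxy
    obtain ⟨z, hz, hz'⟩ := hvars a ha x hx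
    obtain ⟨z', hz₂, hz₂'⟩ := hvars b hb y hy
    have : z' ≠ z := by
      rintro rfl
      rw [hz'] at hz₂'
      exact hxy (FirstOrder.Language.Term.var.inj hz₂')
    simpa [hz, hz₂] using this)
  rw [query_tidy_iff, Query.map_item_subst]
  rw [List.map_map] at h
  simpa only [Function.comp_def, Item.bind_termVars_subst, ← hθσ] using h

theorem wnsto_atoms {n : ℕ} {p : L.Relations n} {s t : Fin n → L.Term V}
    {r : Option (V → L.Term V)} (h : Solve (Set.range fun i => (s i, t i)) r) :
    WNSTO {Equation.atom (⟨n, p, s⟩ : Atom L V) ⟨n, p, t⟩} := by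
  obtain ⟨as, hrun, has⟩ := h.exists_run ∅ fun e he => absurd he (Set.notMem_empty e)
  refine ⟨.decompose :: as, .act (.decomposeAtom p s t rfl) ?_, by simpa using has⟩
  convert hrun using 2
  rw [sdiff_self, Set.empty_union, ← Set.range_comp]
  exact Set.empty_union _

/-! ### Derivations -/

theorem Atom.mem_vars_subst {A : Atom L V} {θ : Subst L V} {y : V}
    (h : y ∈ (A.subst θ.toFun).vars) : y ∈ A.vars ∨ y ∈ θ.vars := by
  obtain ⟨i, hi⟩ := h
  have hi : y ∈ termVars ((A.args i).subst θ.toFun) := hi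
  rw [termVars_subst, List.mem_flatMap] at hi
  obtain ⟨x, hx, hy⟩ := hi
  by_cases hd : θ.toFun x = .var x
  · rw [hd, termVars_var, List.mem_singleton] at hy
    exact .inl ⟨i, hy ▸ hx⟩
  · exact .inr (.inr ⟨x, hd, hy⟩)

theorem lastQuery_mem_queries (Q : Query L V) (ξ : List (SLDStep L V)) :
    lastQuery Q ξ ∈ queries Q ξ := by
  unfold lastQuery queries
  cases h : ξ.getLast? with
  | none => simp
  | some st => exact List.mem_cons_of_mem _ (List.mem_map_of_mem (List.mem_of_getLast? h))

/-- An mgu may introduce variables foreign to the atoms it unifies, so the variables of the mgus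
have to be listed as a separate source. -/
theorem SLDDerivation.vars_lastQuery {P : Set (Clause L V)} {R : SelectionRule L V}
    {Q : Query L V} {ξ : List (SLDStep L V)} (h : SLDDerivation P R Q ξ) :
    ∀ x ∈ Query.vars (lastQuery Q ξ), x ∈ Query.vars Q ∨
      ∃ st ∈ ξ, x ∈ st.clause.vars ∨ x ∈ st.mgu.vars := by
  induction h with
  | nil => exact fun x hx => .inl hx
  | @step ξ h i A hA c hc θ hθ ih =>
    rintro x ⟨A', hA', hx⟩
    simp only [lastQuery, List.getLast?_append, List.getLast?_singleton, Option.some_or,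
      Option.map_some, Option.getD_some, Query.subst, List.mem_map] at hA'
    obtain ⟨A', hA', rfl⟩ := hA'
    rcases Atom.mem_vars_subst hx with hx | hx
    · simp only [List.mem_append] at hA'
      rcases hA' with (hA' | hA') | hA'
      · exact (ih x ⟨A', List.mem_of_mem_take hA', hx⟩).imp_right
          fun ⟨st, hst, hx⟩ => ⟨st, by simp [hst], hx⟩
      · exact .inr ⟨_, List.mem_append_right _ (List.mem_singleton_self _),
          .inl (.inr ⟨A', hA', hx⟩)⟩
      · exact (ih x ⟨A', List.mem_of_mem_drop hA', hx⟩).imp_right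
          fun ⟨st, hst, hx⟩ => ⟨st, by simp [hst], hx⟩
    · exact .inr ⟨_, List.mem_append_right _ (List.mem_singleton_self _), .inr hx⟩

theorem SLDDerivation.disjoint_lastQuery {P : Set (Clause L V)} {R : SelectionRule L V}
    {Q : Query L V} {ξ : List (SLDStep L V)} (h : SLDDerivation P R Q ξ) {c : Clause L V}
    (hc : StandardizedApart P Q ξ c) : Disjoint c.vars (Query.vars (lastQuery Q ξ)) := by
  rw [Set.disjoint_left]
  intro x hxc hx
  rcases h.vars_lastQuery x hx with hx | ⟨st, hst, hx | hx⟩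
  · exact Set.disjoint_left.1 hc.2.1 hxc hx
  · exact Set.disjoint_left.1 (hc.2.2 st hst).1 hxc hx
  · exact Set.disjoint_left.1 (hc.2.2 st hst).2 hxc hx

theorem eq_take_append_cons_drop {α : Type*} {l : List α} {i : ℕ} {a : α} (h : l[i]? = some a) :
    l = l.take i ++ a :: l.drop (i + 1) := by
  obtain ⟨hi, rfl⟩ := List.getElem?_eq_some_iff.1 h
  rw [List.getElem_cons_drop, List.take_append_drop]

theorem SLDDerivation.tidy {M : Moding3 L} {M' : Moding L} {P : Set (Clause L V)}
    {Q : Query L V} (hP : WeaklyTidy M M' P) (hQ : Query.Tidy M' Q) {R : SelectionRule L V}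
    (hR : R.Compatible M P Q) {ξ : List (SLDStep L V)} (h : SLDDerivation P R Q ξ) :
    ∀ q ∈ queries Q ξ, Query.Tidy M' q := by
  induction h with
  | nil => simpa [queries] using hQ
  | @step ξ h i A hA c hc θ hθ ih =>
    intro q hq
    simp only [queries, List.map_append, List.map_cons, List.map_nil, List.mem_cons,
      List.mem_append, List.not_mem_nil, or_false] at hq
    rcases hq with rfl | hq | rfl
    · exact hQ
    · exact ih q (List.mem_cons_of_mem _ hq)
    · have hlast := ih _ (lastQuery_mem_queries Q ξ)
      have hd := h.disjoint_lastQuery hc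
      have hg := (hR ξ h).1 i A hA
      rw [eq_take_append_cons_drop hA.2] at hlast hd
      obtain ⟨C, hC, hcC⟩ := hc.1
      obtain ⟨n, p, s⟩ := A
      obtain ⟨⟨m, p', t⟩, B⟩ := c
      -- Unifiability forces equal predicate symbols, so both atoms can be written with the same
      -- `p`.
      have hu := hθ.1
      simp only [IsUnifier, Atom.subst, Atom.mk.injEq] at hu
      obtain ⟨rfl, hp, -⟩ := hu
      obtain rfl := eq_of_heq hp
      exact tidy_resolvent hP hC hcC hlast hd hg hθ

end LP

theorem mainTheorem7 {L : FirstOrder.Language} {V : Type*} [Infinite V]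
    (M : LP.Moding3 L) (M' : LP.Moding L) (P : Set (LP.Clause L V)) (Q : LP.Query L V)
    (hP : LP.WeaklyTidy M M' P) (hQ : LP.Query.Tidy M' Q)
    (R : LP.SelectionRule L V) (hR : R.Compatible M P Q) :
    (∀ ξ, LP.SLDDerivation P R Q ξ → ∀ q ∈ LP.queries Q ξ, LP.Query.Tidy M' q) ∧
    LP.WeaklyOccurCheckFree P R Q := by
  refine ⟨fun ξ hξ => hξ.tidy hP hQ hR, ?_⟩
  rintro A H ⟨ξ, hξ, ⟨i, hA⟩, ⟨c, hc, rfl⟩, hsame⟩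
  have hlast := hξ.tidy hP hQ hR _ (LP.lastQuery_mem_queries Q ξ)
  have hd := hξ.disjoint_lastQuery hc
  have hg := (hR ξ hξ).1 i A hA
  rw [LP.eq_take_append_cons_drop hA.2] at hlast hd
  obtain ⟨C, hC, hcC⟩ := hc.1
  obtain ⟨n, p, s⟩ := A
  obtain ⟨⟨m, p', t⟩, B⟩ := c
  simp only [LP.SamePred] at hsame
  cases hsame
  obtain ⟨r, hr, -⟩ := LP.exists_solve_resolve hP hC hcC hlast hd hg
  exact LP.wnsto_atoms hr
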